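/- Let $A$ be a real $d\times d$ matrix with spectral radius $\rho(A)<1$, let $C=(I-A)^{-1}$, and let $P$ be the transition matrix of an irreducible aperiodic Markov chain on $[d]=\{1,\dots,d\}$ such that $A_{ij}=0$ whenever $P_{ij}=0$. Assume $\rho(\widehat H)<1$, where $\widehat H_{ij}=A_{ij}^2/P_{ij}$ if $P_{ij}\ne 0$ and $\widehat H_{ij}=0$ otherwise. Let $X(0),X(1),\dots$ be a Markov chain with transition matrix $P$ and arbitrary initial distribution. The regenerative Ulam–von Neumann algorithm keeps three $d\times d$ matrices $\Lambda$ (running weights), $\Sigma$ (cumulative weights) and $\Gamma$ (cycle counts), all zero at the start. At a transition of the chain from $i$ to $j$ it does the following, in this order: every zero entry of the $i$-th row of $\Lambda$ is set to $1$; $\Lambda$ is multiplied by the scalar $A_{ij}/P_{ij}$; for every $k\in[d]$, $\Gamma_{kj}$ is increased by $1$ if $\Lambda_{kj}\neq 0$ and $\Sigma_{kj}$ is increased by $\Lambda_{kj}$; the $j$-th column of $\Lambda$ is set to $0$. Let $\Sigma^K$ and $\Gamma^K$ be the matrices $\Sigma$ and $\Gamma$ after $K$ transitions. Then there exist a $d\times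 d$ matrix $\Gamma_s$ and a symmetric positive semi-definite $d^2\times d^2$ matrix $\Sigma_a$, depending only on $A$ and $P$, such that, with $(\widehat\Gamma_s)_{ij}=(\Gamma_s)_{ij}C_{ij}$ for $i,j\in[d]$, $$\sqrt K\Big(\frac{\Sigma^K}{K}-\widehat\Gamma_s\Big)\longrightarrow N(0,\Sigma_a)\quad\text{in distribution as }K\to\infty,$$ the $d^2$-variate normal law with mean $0$ and covariance matrix $\Sigma_a$. Moreover, if in addition $A_{ij}\neq 0$ whenever $P_{ij}\ne 0$, then there is a $d\times d$ matrix $\gamma$, depending only on $A$ and $P$, such that $\Gamma^K/K\to\gamma$ almost surely, and $$(\widehat\Gamma_s)_{jj}=\gamma_{jj}\Big(1-\frac1{C_{jj}}\Big),\qquad (\widehat\Gamma_s)_{ij}=\gamma_{ij}\,\frac{C_{ij}}{C_{jj}}\quad(i\neq j).$$ -/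

import Mathlib

open MeasureTheory ProbabilityTheory Filter
open scoped Topology ENNReal

namespace RegenUvN

/-- The spectral radius `ρ(M)` of a real matrix: the largest modulus of its complex eigenvalues. -/
noncomputable def specRad {d : ℕ} (M : Matrix (Fin d) (Fin d) ℝ) : ℝ≥0∞ :=
  spectralRadius ℂ (M.map ((↑) : ℝ → ℂ))

/-- The matrix deciding the convergence of the Ulam-von Neumann algorithm for `A` sampled with
`P`: its entries are `A i j ^ 2 / P i j` where `P i j ≠ 0`, and `0` elsewhere. -/
noncomputable def secondMomentMatrix {d : ℕ} (A P : Matrix (Fin d) (Fin d) ℝ) :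
    Matrix (Fin d) (Fin d) ℝ :=
  fun i j => if P i j ≠ 0 then A i j ^ 2 / P i j else 0

/-- Aperiodicity: for every state `i`, the gcd of `{n ≥ 1 | (P ^ n) i i > 0}` is `1`. -/
def Aperiodic {d : ℕ} (P : Matrix (Fin d) (Fin d) ℝ) : Prop :=
  ∀ i : Fin d, ∀ p : ℕ, (∀ n : ℕ, 0 < n → 0 < (P ^ n) i i → p ∣ n) → p = 1

/-- `X` is a time-homogeneous Markov chain on `Fin d` with transition matrix `P` (and an arbitrary
initial distribution) under `μ`. -/
structure IsMarkovChain {d : ℕ} {Ω : Type*} [MeasurableSpace Ω] (μ : Measure Ω)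
    (P : Matrix (Fin d) (Fin d) ℝ) (X : ℕ → Ω → Fin d) : Prop where
  measurable : ∀ n, Measurable (X n)
  step : ∀ (n : ℕ) (x : ℕ → Fin d),
    μ.real {ω | ∀ k ≤ n + 1, X k ω = x k} =
      μ.real {ω | ∀ k ≤ n, X k ω = x k} * P (x n) (x (n + 1))

/-- The three matrices kept by the regenerative Ulam-von Neumann algorithm. -/
structure AlgState (d : ℕ) where
  /-- the running weights `Λ` of the open cycles -/
  running : Matrix (Fin d) (Fin d) ℝ
  /-- the cumulative weights `Σ` of the closed cycles -/
  total : Matrix (Fin d) (Fin d) ℝ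
  /-- the counts `Γ` of the closed cycles -/
  count : Matrix (Fin d) (Fin d) ℕ

/-- `Λ` after the update of row `i`: the entries of row `i` that are `0` are set to `1`. -/
noncomputable def restartRow {d : ℕ} (i : Fin d) (L : Matrix (Fin d) (Fin d) ℝ) :
    Matrix (Fin d) (Fin d) ℝ :=
  fun k l => if k = i ∧ L k l = 0 then 1 else L k l

/-- `Λ` after the update of row `i` and the multiplication by `A i j / P i j`. -/
noncomputable def scaledWeights {d : ℕ} (A P : Matrix (Fin d) (Fin d) ℝ) (i j : Fin d)
    (L : Matrix (Fin d) (Fin d) ℝ) : Matrix (Fin d) (Fin d) ℝ :=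
  (A i j / P i j) • restartRow i L

/-- One pass through the loop of the algorithm, the chain moving from `i` to `j`. -/
noncomputable def AlgState.next {d : ℕ} (A P : Matrix (Fin d) (Fin d) ℝ) (i j : Fin d)
    (s : AlgState d) : AlgState d where
  running := fun k l => if l = j then 0 else scaledWeights A P i j s.running k l
  total := fun k l =>
    if l = j then s.total k l + scaledWeights A P i j s.running k l else s.total k l
  count := fun k l =>
    if l = j ∧ scaledWeights A P i j s.running k l ≠ 0 then s.count k l + 1 else s.count k l

/-- The state of the algorithm after `K` transitions along the path `x 0, x 1, …`, all three
matrices being `0` at the start. -/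
noncomputable def run {d : ℕ} (A P : Matrix (Fin d) (Fin d) ℝ) (x : ℕ → Fin d) : ℕ → AlgState d
  | 0 => ⟨0, 0, 0⟩
  | K + 1 => (run A P x K).next A P (x K) (x (K + 1))

/-- The matrix `Σ^K` of cumulative weights after `K` transitions. -/
noncomputable def cumWeights {d : ℕ} (A P : Matrix (Fin d) (Fin d) ℝ) (x : ℕ → Fin d) (K : ℕ) :
    Matrix (Fin d) (Fin d) ℝ :=
  (run A P x K).total

/-- The matrix `Γ^K` of cycle counts after `K` transitions. -/
noncomputable def cycleCounts {d : ℕ} (A P : Matrix (Fin d) (Fin d) ℝ) (x : ℕ → Fin d) (K : ℕ) :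
    Matrix (Fin d) (Fin d) ℕ :=
  (run A P x K).count

/-- `√K (M / K - G)` as a vector of `ℝ^(d²)` with the Euclidean norm. -/
noncomputable def scaledDeviation {d : ℕ} (M G : Matrix (Fin d) (Fin d) ℝ) (K : ℕ) :
    EuclideanSpace ℝ (Fin d × Fin d) :=
  WithLp.toLp 2 fun p => √(K : ℝ) * (M p.1 p.2 / (K : ℝ) - G p.1 p.2)

end RegenUvN

/-!
# Central limit theorem for the regenerative Ulam-von Neumann algorithm

For a pair `a = (k, l)`, the running weight `Λ k l` of the open cycle is started with the value `1`
when the chain leaves `k` while `Λ k l = 0`, is multiplied by `A i j / P i j` at each transition,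
and is collected on arrival at `l`. Let `w j = C j l / C l l`. From `(1 - A) C = 1` one gets that
`v = A w` is the mean weight of a cycle (`cycleWeight`), so that `Σ k l + v (X n) Λ k l` is a
martingale up to a drift of `v k` at each start of a cycle. Whether a cycle is started depends only
on the position and on the set of nonzero running weights. This is a finite chain, on which every
function is a constant plus a coboundary (`exists_poisson_pattern`): two copies of the chain moved
along one closed path through all states coalesce, because arriving at `l` resets column `l`
(`harmonic_const_of_reset`). The constant `c a` is the rate of starts. Therefore `Σ k l` is
`K c a v k` plus a martingale plus a boundary term (`pathSum_increment_eq`), and the limit matrix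
has the entries `c a v k`, where `v k` is `C k l / C l l` or `1 - 1 / C l l`. If all possible
transitions have nonzero weights, then `Γ k l` counts the starts up to one (`cycleCounts_eq`), and
the strong law for martingales with bounded increments, which follows from fourth moments,
identifies `c a` as the limit of `Γ k l / K`.

The central limit theorem for the martingale comes from a recursion. The increments are affine in
`Λ`, so that their conditional covariances are polynomials of degree two in `Λ` with coefficients
depending on the finite chain. The Poisson equation is solvable for these as well
(`exists_isCorrector_bilinear`, `exists_isCorrector_linear`): the leading coefficient is removed by
inverting `1 - T`, where the entries of `T` are dominated by the second moment matrix `Ĥ` or by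
`|A|`, and terms of lower degree remain. Hence the conditional variance of a combination `θ` of the
increments is `θᵀ V θ + G - E[G']`, where `G'` is the value of `G` after the step. With the
corrected characteristic function `Ψₙ = E[exp (i h Sₙ) (1 - h² Gₙ / 2)]` the coboundary cancels,
and `Ψₙ₊₁ = (1 - h² θᵀ V θ / 2) Ψₙ` up to an error `O(h^(2 + δ))`, which for `h = 1 / √K` vanishes
after `K` steps (`IsMarkovChain.tendsto_charFun_pathSum`). Lévy's continuity theorem concludes.

The spectral condition enters through one vector `u ≥ 1` with `Ĥ u ≤ β u` and `β < 1`
(`exists_isSubinvariant`). By continuity in the exponent, `u` gives a drift inequality for moments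
of the running weights of an order `2 + δ`, and by the Cauchy-Schwarz inequality
`|A| √u ≤ √β √u`, which makes `1 - A` invertible and all `C l l` nonzero.
-/

namespace RegenUvN

/-! ### Path functionals of a Markov chain -/

section Path

variable {d : ℕ} {Ω : Type*} [MeasurableSpace Ω] {μ : Measure Ω}
  {P : Matrix (Fin d) (Fin d) ℝ} {X : ℕ → Ω → Fin d}

/-- The path that follows `y` up to time `n` and stays there afterwards. -/
def stopPath {d n : ℕ} (y : Fin (n + 1) → Fin d) : ℕ → Fin d :=
  fun k => y ⟨min k n, by omega⟩

lemma stopPath_eq {n k : ℕ} (hk : k ≤ n) (x : ℕ → Fin d) :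
    stopPath (fun m : Fin (n + 1) => x m) k = x k := by
  simp [stopPath, hk]

lemma apply_stopPath_of_dependsOn {E : Type*} {n : ℕ} {φ : (ℕ → Fin d) → E}
    (hφ : DependsOn φ (Set.Iic n)) (x : ℕ → Fin d) :
    φ (stopPath fun m : Fin (n + 1) => x m) = φ x :=
  hφ fun _ hk => stopPath_eq hk x

lemma IsMarkovChain.measurable_start (hX : IsMarkovChain μ P X) (n : ℕ) :
    Measurable fun ω => (fun m : Fin (n + 1) => X m ω) :=
  measurable_pi_lambda _ fun _ => hX.measurable _

lemma IsMarkovChain.measurable_comp {E : Type*} [MeasurableSpace E] (hX : IsMarkovChain μ P X)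
    {n : ℕ} {φ : (ℕ → Fin d) → E} (hφ : DependsOn φ (Set.Iic n)) :
    Measurable fun ω => φ fun k => X k ω := by
  have h : (fun ω => φ fun k => X k ω) =
      (fun y => φ (stopPath y)) ∘ fun ω => (fun m : Fin (n + 1) => X m ω) := by
    funext ω
    exact (apply_stopPath_of_dependsOn hφ fun k => X k ω).symm
  rw [h]
  exact (Measurable.of_discrete).comp (hX.measurable_start n)

lemma IsMarkovChain.integrable_comp {E : Type*} [NormedAddCommGroup E] [IsFiniteMeasure μ]
    (hX : IsMarkovChain μ P X) {n : ℕ} {φ : (ℕ → Fin d) → E} (hφ : DependsOn φ (Set.Iic n)) :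
    Integrable (fun ω => φ fun k => X k ω) μ := by
  have h : (fun ω => φ fun k => X k ω) =
      (fun y => φ (stopPath y)) ∘ fun ω => (fun m : Fin (n + 1) => X m ω) := by
    funext ω
    exact (apply_stopPath_of_dependsOn hφ fun k => X k ω).symm
  rw [h]
  exact (Integrable.of_finite).comp_measurable (hX.measurable_start n)

/-- The Markov property for functionals of the path: the last step may be averaged out with the
transition probabilities. -/
lemma IsMarkovChain.integral_step {E : Type*} [NormedAddCommGroup E] [NormedSpace ℝ E]
    [CompleteSpace E] [IsFiniteMeasure μ] (hX : IsMarkovChain μ P X) (n : ℕ)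
    {Φ : (ℕ → Fin d) → Fin d → E} (hΦ : DependsOn Φ (Set.Iic n)) :
    ∫ ω, Φ (fun k => X k ω) (X (n + 1) ω) ∂μ =
      ∫ ω, ∑ j, P (X n ω) j • Φ (fun k => X k ω) j ∂μ := by
  have hY := hX.measurable_start n
  have hZ : Measurable fun ω => ((fun m : Fin (n + 1) => X m ω), X (n + 1) ω) :=
    hY.prodMk (hX.measurable _)
  have hL : ∫ ω, Φ (fun k => X k ω) (X (n + 1) ω) ∂μ =
      ∫ p, Φ (stopPath p.1) p.2
        ∂(μ.map fun ω => ((fun m : Fin (n + 1) => X m ω), X (n + 1) ω)) := by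
    rw [integral_map hZ.aemeasurable (Integrable.of_finite).aestronglyMeasurable]
    refine integral_congr_ae (ae_of_all _ fun ω => ?_)
    simp only [apply_stopPath_of_dependsOn hΦ fun k => X k ω]
  have hR : ∫ ω, ∑ j, P (X n ω) j • Φ (fun k => X k ω) j ∂μ =
      ∫ y, ∑ j, P (y (Fin.last n)) j • Φ (stopPath y) j
        ∂(μ.map fun ω => (fun m : Fin (n + 1) => X m ω)) := by
    rw [integral_map hY.aemeasurable (Integrable.of_finite).aestronglyMeasurable]
    refine integral_congr_ae (ae_of_all _ fun ω => ?_)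
    simp only [apply_stopPath_of_dependsOn hΦ fun k => X k ω, Fin.val_last]
  have hm : ∀ (y : Fin (n + 1) → Fin d) (j : Fin d),
      (μ.map fun ω => ((fun m : Fin (n + 1) => X m ω), X (n + 1) ω)).real {(y, j)} =
        (μ.map fun ω => (fun m : Fin (n + 1) => X m ω)).real {y} * P (y (Fin.last n)) j := by
    intro y j
    rw [map_measureReal_apply hZ (MeasurableSet.singleton _),
      map_measureReal_apply hY (MeasurableSet.singleton _)]
    have h := hX.step n fun k => if h : k < n + 1 then y ⟨k, h⟩ else j
    have e1 : {ω | ∀ k ≤ n + 1, X k ω = if h : k < n + 1 then y ⟨k, h⟩ else j} =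
        (fun ω => ((fun m : Fin (n + 1) => X m ω), X (n + 1) ω)) ⁻¹' {(y, j)} := by
      ext ω
      simp only [Set.mem_ofPred_eq, Set.mem_preimage, Set.mem_singleton_iff, Prod.mk.injEq,
        funext_iff]
      constructor
      · intro h
        refine ⟨fun m => ?_, ?_⟩
        · rw [h m (by omega), dif_pos m.2]
        · rw [h (n + 1) le_rfl, dif_neg (by omega)]
      · rintro ⟨h1, h2⟩ k hk
        by_cases hk' : k < n + 1
        · rw [dif_pos hk', ← h1 ⟨k, hk'⟩]
        · obtain rfl : k = n + 1 := by omega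
          rw [dif_neg hk', h2]
    have e2 : {ω | ∀ k ≤ n, X k ω = if h : k < n + 1 then y ⟨k, h⟩ else j} =
        (fun ω => (fun m : Fin (n + 1) => X m ω)) ⁻¹' {y} := by
      ext ω
      simp only [Set.mem_ofPred_eq, Set.mem_preimage, Set.mem_singleton_iff, funext_iff]
      constructor
      · intro h m
        rw [h m (by omega), dif_pos m.2]
      · intro h1 k hk
        rw [dif_pos (by omega), ← h1 ⟨k, by omega⟩]
    rw [e1, e2] at h
    rw [h, dif_pos (by omega), dif_neg (by omega)]
    rfl
  rw [hL, hR, integral_fintype (Integrable.of_finite), integral_fintype (Integrable.of_finite),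
    Fintype.sum_prod_type]
  refine Finset.sum_congr rfl fun y _ => ?_
  rw [Finset.smul_sum]
  refine Finset.sum_congr rfl fun j _ => ?_
  rw [hm, mul_smul]

end Path

/-! ### Chains with a driven component -/

section Driven

variable {d : ℕ} {S : Type*}

/-- The state at time `n` of a system started at `s₀` and updated by `τ i j` whenever the path
moves from `i` to `j`. -/
def pathState (τ : Fin d → Fin d → S → S) (s₀ : S) (x : ℕ → Fin d) : ℕ → S
  | 0 => s₀
  | n + 1 => τ (x n) (x (n + 1)) (pathState τ s₀ x n)

/-- The transition operator of the Markov chain formed by the position and the driven state. -/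
def transOp (P : Matrix (Fin d) (Fin d) ℝ) (τ : Fin d → Fin d → S → S) (F : Fin d → S → ℝ) :
    Fin d → S → ℝ :=
  fun i s => ∑ j, P i j * F j (τ i j s)

/-- The sum of `D (x n) sₙ (x (n + 1))` over the first `K` transitions of a path, `sₙ` being the
driven state. -/
def pathSum (τ : Fin d → Fin d → S → S) (s₀ : S) (D : Fin d → S → Fin d → ℝ) (x : ℕ → Fin d)
    (K : ℕ) : ℝ :=
  ∑ n ∈ Finset.range K, D (x n) (pathState τ s₀ x n) (x (n + 1))

variable {τ : Fin d → Fin d → S → S} {s₀ : S}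

lemma pathSum_succ (D : Fin d → S → Fin d → ℝ) (x : ℕ → Fin d) (K : ℕ) :
    pathSum τ s₀ D x (K + 1) =
      pathSum τ s₀ D x K + D (x K) (pathState τ s₀ x K) (x (K + 1)) :=
  Finset.sum_range_succ _ _

lemma dependsOn_pathState (n : ℕ) :
    DependsOn (fun x => pathState τ s₀ x n) (Set.Iic n) := by
  induction n with
  | zero => intro x y _; rfl
  | succ n ih =>
    intro x y h
    have h1 : pathState τ s₀ x n = pathState τ s₀ y n :=
      ih fun k hk => h k (Set.mem_Iic.2 (by have := Set.mem_Iic.1 hk; omega))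
    simp only [pathState, h1, h n (Set.mem_Iic.2 (Nat.le_succ n)),
      h (n + 1) (Set.mem_Iic.2 le_rfl)]

lemma dependsOn_pathSum (D : Fin d → S → Fin d → ℝ) (n : ℕ) :
    DependsOn (fun x => pathSum τ s₀ D x n) (Set.Iic n) := by
  induction n with
  | zero => intro x y _; simp [pathSum]
  | succ n ih =>
    intro x y h
    have h0 : ∀ k ∈ Set.Iic n, x k = y k := fun k hk =>
      h k (Set.mem_Iic.2 (by have := Set.mem_Iic.1 hk; omega))
    have h1 : pathState τ s₀ x n = pathState τ s₀ y n := dependsOn_pathState n h0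
    have h2 : pathSum τ s₀ D x n = pathSum τ s₀ D y n := ih h0
    simp only [pathSum_succ, h1, h2, h n (Set.mem_Iic.2 (Nat.le_succ n)),
      h (n + 1) (Set.mem_Iic.2 le_rfl)]

/-- A functional of the position, the driven state and the accumulated sum at time `n` depends on
the path up to time `n` only. -/
lemma dependsOn_state {E : Type*} (D : Fin d → S → Fin d → ℝ) (n : ℕ)
    (ψ : Fin d → S → ℝ → E) :
    DependsOn (fun x => ψ (x n) (pathState τ s₀ x n) (pathSum τ s₀ D x n)) (Set.Iic n) := by
  intro x y h
  have h1 : pathState τ s₀ x n = pathState τ s₀ y n := dependsOn_pathState n h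
  have h2 : pathSum τ s₀ D x n = pathSum τ s₀ D y n := dependsOn_pathSum D n h
  simp only [h1, h2, h n (Set.mem_Iic.2 le_rfl)]

variable {Ω : Type*} [MeasurableSpace Ω] {μ : Measure Ω} [IsProbabilityMeasure μ]
  {P : Matrix (Fin d) (Fin d) ℝ} {X : ℕ → Ω → Fin d}

lemma IsMarkovChain.integrable_state {E : Type*} [NormedAddCommGroup E]
    (hX : IsMarkovChain μ P X) (D : Fin d → S → Fin d → ℝ) (n : ℕ) (ψ : Fin d → S → ℝ → E) :
    Integrable (fun ω => ψ (X n ω) (pathState τ s₀ (fun k => X k ω) n)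
      (pathSum τ s₀ D (fun k => X k ω) n)) μ :=
  hX.integrable_comp (dependsOn_state D n ψ)

/-- The Markov property of the position, the driven state and the accumulated sum. -/
lemma IsMarkovChain.integral_state_succ {E : Type*} [NormedAddCommGroup E] [NormedSpace ℝ E]
    [CompleteSpace E] (hX : IsMarkovChain μ P X) (D : Fin d → S → Fin d → ℝ) (n : ℕ)
    (ψ : Fin d → S → ℝ → E) :
    ∫ ω, ψ (X (n + 1) ω) (pathState τ s₀ (fun k => X k ω) (n + 1))
        (pathSum τ s₀ D (fun k => X k ω) (n + 1)) ∂μ =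
      ∫ ω, ∑ j, P (X n ω) j •
        ψ j (τ (X n ω) j (pathState τ s₀ (fun k => X k ω) n))
          (pathSum τ s₀ D (fun k => X k ω) n +
            D (X n ω) (pathState τ s₀ (fun k => X k ω) n) j) ∂μ := by
  have h := hX.integral_step n
    (Φ := fun x j => ψ j (τ (x n) j (pathState τ s₀ x n))
      (pathSum τ s₀ D x n + D (x n) (pathState τ s₀ x n) j))
    (dependsOn_state D n fun i s r j => ψ j (τ i j s) (r + D i s j))
  rw [← h]
  simp only [pathState, pathSum_succ]

lemma IsMarkovChain.ae_pos (hX : IsMarkovChain μ P X) (hP : ∀ i j, 0 ≤ P i j) :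
    ∀ᵐ ω ∂μ, ∀ n, 0 < P (X n ω) (X (n + 1) ω) := by
  rw [ae_all_iff]
  intro n
  have h := hX.integral_step n
    (Φ := fun x j => if 0 < P (x n) j then (0 : ℝ) else 1)
    (fun x y h => by simp only [h n (Set.mem_Iic.2 le_rfl)])
  have h0 : ∀ i : Fin d, ∑ j, P i j • (if 0 < P i j then (0 : ℝ) else 1) = 0 := by
    intro i
    refine Finset.sum_eq_zero fun j _ => ?_
    split_ifs with hj
    · simp
    · simp [le_antisymm (not_lt.1 hj) (hP i j)]
  simp only [h0, integral_zero] at h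
  have hint : Integrable
      (fun ω => if 0 < P (X n ω) (X (n + 1) ω) then (0 : ℝ) else 1) μ :=
    hX.integrable_comp (n := n + 1) (φ := fun x => if 0 < P (x n) (x (n + 1)) then (0 : ℝ) else 1)
      (fun x y h => by
        simp only [h n (Set.mem_Iic.2 (Nat.le_succ n)), h (n + 1) (Set.mem_Iic.2 le_rfl)])
  rw [integral_eq_zero_iff_of_nonneg (fun ω => by positivity) hint] at h
  filter_upwards [h] with ω hω
  by_contra hcon
  simp [hcon] at hω

/-- A Foster-Lyapunov drift inequality bounds all expectations of the Lyapunov function. -/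
lemma IsMarkovChain.integral_le_of_drift (hX : IsMarkovChain μ P X) {V : Fin d → S → ℝ}
    {β b B : ℝ} (hβ0 : 0 ≤ β) (hV : ∀ i s, transOp P τ V i s ≤ β * V i s + b)
    (hB : ∀ i, V i s₀ ≤ B) (hbB : b ≤ (1 - β) * B) (n : ℕ) :
    ∫ ω, V (X n ω) (pathState τ s₀ (fun k => X k ω) n) ∂μ ≤ B := by
  have hint := fun n (F : Fin d → S → ℝ) =>
    hX.integrable_state (τ := τ) (s₀ := s₀) (fun _ _ _ => 0) n fun i s _ => F i s
  induction n with
  | zero =>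
    calc _ ≤ ∫ ω, B ∂μ := integral_mono (hint 0 V) (integrable_const _) fun ω => hB _
      _ = B := by simp
  | succ n ih =>
    have h := hX.integral_state_succ (τ := τ) (s₀ := s₀) (fun _ _ _ => 0) n fun i s _ => V i s
    rw [h]
    calc _ ≤ ∫ ω, (β * V (X n ω) (pathState τ s₀ (fun k => X k ω) n) + b) ∂μ :=
          integral_mono (hint n (transOp P τ V)) (hint n fun i s => β * V i s + b) fun ω => hV _ _
      _ = β * ∫ ω, V (X n ω) (pathState τ s₀ (fun k => X k ω) n) ∂μ + b := by
          rw [integral_add ((hint n V).const_mul β) (integrable_const _), integral_const_mul]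
          simp
      _ ≤ B := by nlinarith

end Driven

/-! ### The central limit theorem for martingales with a corrector -/

lemma norm_exp_I_mul_sub_le {δ : ℝ} (h0 : 0 ≤ δ) (h1 : δ ≤ 1) (y : ℝ) :
    ‖Complex.exp (Complex.I * y) - 1‖ ≤ 2 * |y| ^ δ := by
  rcases le_total |y| 1 with hy | hy
  · have h : ‖Complex.exp (Complex.I * y) - 1‖ ≤ ‖y‖ := Real.norm_exp_I_mul_ofReal_sub_one_le
    have h2 : |y| ≤ |y| ^ δ := Real.self_le_rpow_of_le_one (abs_nonneg _) hy h1
    rw [Real.norm_eq_abs] at h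
    linarith [abs_nonneg y]
  · have h : ‖Complex.exp (Complex.I * y) - 1‖ ≤ 1 + 1 := by
      refine (norm_sub_le _ _).trans ?_
      rw [mul_comm, Complex.norm_exp_ofReal_mul_I, norm_one]
    have h2 : (1 : ℝ) ≤ |y| ^ δ := Real.one_le_rpow hy h0
    linarith

lemma norm_exp_I_mul_taylor_two_le {δ : ℝ} (h0 : 0 ≤ δ) (h1 : δ ≤ 1) (y : ℝ) :
    ‖Complex.exp (Complex.I * y) - (1 + Complex.I * y - (y : ℂ) ^ 2 / 2)‖
      ≤ 4 * |y| ^ (2 + δ) := by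
  rcases le_total |y| 1 with hy | hy
  · have h := Complex.exp_bound (x := Complex.I * y) (by simpa using hy) (n := 3) (by norm_num)
    have hs : ∑ m ∈ Finset.range 3, (Complex.I * (y : ℂ)) ^ m / (m.factorial : ℂ) =
        1 + Complex.I * y - (y : ℂ) ^ 2 / 2 := by
      simp only [Finset.sum_range_succ, Finset.sum_range_zero, Nat.factorial, mul_pow,
        Complex.I_sq]
      push_cast
      ring
    rw [hs] at h
    refine h.trans ?_
    have hy3 : |y| ^ (3 : ℕ) ≤ |y| ^ (2 + δ) := by
      rw [← Real.rpow_natCast]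
      rcases (abs_nonneg y).eq_or_lt with hz | hz
      · rw [← hz, Real.zero_rpow (by norm_num), Real.zero_rpow (by linarith)]
      · exact Real.rpow_le_rpow_of_exponent_ge hz hy (by push_cast; linarith)
    have hn : ‖Complex.I * (y : ℂ)‖ = |y| := by simp
    rw [hn]
    have : 0 ≤ |y| ^ 3 := by positivity
    norm_num [Nat.factorial]
    linarith
  · have hb : ‖Complex.exp (Complex.I * y) - (1 + Complex.I * y - (y : ℂ) ^ 2 / 2)‖ ≤
        1 + (1 + |y| + |y| ^ 2 / 2) := by
      refine (norm_sub_le _ _).trans (add_le_add ?_ ?_)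
      · rw [mul_comm, Complex.norm_exp_ofReal_mul_I]
      · refine (norm_sub_le _ _).trans (add_le_add ((norm_add_le _ _).trans ?_) ?_)
        · simp
        · simp
    refine hb.trans ?_
    have h2 : |y| ^ (2 : ℕ) ≤ |y| ^ (2 + δ) := by
      rw [← Real.rpow_natCast]
      exact Real.rpow_le_rpow_of_exponent_le hy (by push_cast; linarith)
    nlinarith

/-- One step of the recursion for the corrected characteristic function. The corrector `G` turns
the conditional variance of the increment into the constant `v`. -/
lemma norm_charFun_step_le {ι : Type*} [Fintype ι] {p D G : ι → ℝ} {G₀ v h M δ : ℝ}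
    (hp : ∀ j, 0 ≤ p j) (hp1 : ∑ j, p j = 1) (hδ0 : 0 ≤ δ) (hδ1 : δ ≤ 1) (hv : 0 ≤ v)
    (hh0 : 0 ≤ h) (hh1 : h ≤ 1) (hM : 1 ≤ M) (hmean : ∑ j, p j * D j = 0)
    (hvar : ∑ j, p j * D j ^ 2 = v + G₀ - ∑ j, p j * G j)
    (hD : ∀ j, 0 < p j → |D j| ≤ M) (hG : ∀ j, 0 < p j → |G j| ≤ M ^ 2) (hG₀ : |G₀| ≤ M ^ 2) :
    ‖∑ j, p j • (Complex.exp (Complex.I * ((h * D j : ℝ) : ℂ)) *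
          (1 - ((h ^ 2 * G j / 2 : ℝ) : ℂ))) -
        ((1 - v * h ^ 2 / 2 : ℝ) : ℂ) * (1 - ((h ^ 2 * G₀ / 2 : ℝ) : ℂ))‖
      ≤ (5 + v) * (M * h) ^ (2 + δ) := by
  have hMh : 0 ≤ M * h := by positivity
  have hMsplit : (M * h) ^ (2 + δ) = (M * h) ^ 2 * (M * h) ^ δ := by
    rw [Real.rpow_add_of_nonneg hMh (by norm_num) hδ0]
    norm_num
  set err : ι → ℂ := fun j =>
    (Complex.exp (Complex.I * ((h * D j : ℝ) : ℂ)) -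
      (1 + Complex.I * ((h * D j : ℝ) : ℂ) - ((h * D j : ℝ) : ℂ) ^ 2 / 2)) -
    (Complex.exp (Complex.I * ((h * D j : ℝ) : ℂ)) - 1) * ((h ^ 2 * G j / 2 : ℝ) : ℂ) with herr
  have hsplit : ∑ j, p j • (Complex.exp (Complex.I * ((h * D j : ℝ) : ℂ)) *
          (1 - ((h ^ 2 * G j / 2 : ℝ) : ℂ))) -
        ((1 - v * h ^ 2 / 2 : ℝ) : ℂ) * (1 - ((h ^ 2 * G₀ / 2 : ℝ) : ℂ)) =
      ∑ j, p j • err j - ((v * h ^ 4 * G₀ / 4 : ℝ) : ℂ) := by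
    have hmain : ∑ j, p j • ((1 : ℂ) + Complex.I * ((h * D j : ℝ) : ℂ)
          - ((h * D j : ℝ) : ℂ) ^ 2 / 2 - ((h ^ 2 * G j / 2 : ℝ) : ℂ)) =
        ((1 - h ^ 2 * (v + G₀) / 2 : ℝ) : ℂ) := by
      have e : ∀ j, p j • ((1 : ℂ) + Complex.I * ((h * D j : ℝ) : ℂ)
          - ((h * D j : ℝ) : ℂ) ^ 2 / 2 - ((h ^ 2 * G j / 2 : ℝ) : ℂ)) =
          ((p j - h ^ 2 / 2 * (p j * D j ^ 2) - h ^ 2 / 2 * (p j * G j) : ℝ) : ℂ) +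
            Complex.I * h * ((p j * D j : ℝ) : ℂ) := by
        intro j
        rw [Complex.real_smul]
        push_cast
        ring
      simp only [e]
      rw [Finset.sum_add_distrib, ← Finset.mul_sum, ← Complex.ofReal_sum, ← Complex.ofReal_sum,
        hmean, Finset.sum_sub_distrib, Finset.sum_sub_distrib, ← Finset.mul_sum,
        ← Finset.mul_sum, hvar, hp1]
      push_cast
      ring
    have e2 : ∀ j, p j • (Complex.exp (Complex.I * ((h * D j : ℝ) : ℂ)) *
          (1 - ((h ^ 2 * G j / 2 : ℝ) : ℂ))) =
        p j • ((1 : ℂ) + Complex.I * ((h * D j : ℝ) : ℂ)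
          - ((h * D j : ℝ) : ℂ) ^ 2 / 2 - ((h ^ 2 * G j / 2 : ℝ) : ℂ)) + p j • err j := by
      intro j
      rw [← smul_add]
      congr 1
      simp only [herr]
      ring
    simp only [e2]
    rw [Finset.sum_add_distrib, hmain]
    push_cast
    ring
  have herr_le : ∀ j, ‖p j • err j‖ ≤ p j * (5 * (M * h) ^ (2 + δ)) := by
    intro j
    rw [norm_smul, Real.norm_of_nonneg (hp j)]
    rcases (hp j).eq_or_lt with h0 | h0
    · simp [← h0]
    refine mul_le_mul_of_nonneg_left ?_ (hp j)
    have hy : |h * D j| ≤ M * h := by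
      rw [abs_mul, abs_of_nonneg hh0, mul_comm]
      exact mul_le_mul_of_nonneg_right (hD j h0) hh0
    have h1 := norm_exp_I_mul_taylor_two_le hδ0 hδ1 (h * D j)
    have h2 := norm_exp_I_mul_sub_le hδ0 hδ1 (h * D j)
    have h3 : |h * D j| ^ (2 + δ) ≤ (M * h) ^ (2 + δ) :=
      Real.rpow_le_rpow (abs_nonneg _) hy (by linarith)
    have h4 : |h * D j| ^ δ ≤ (M * h) ^ δ := Real.rpow_le_rpow (abs_nonneg _) hy hδ0
    have h5 : ‖((h ^ 2 * G j / 2 : ℝ) : ℂ)‖ ≤ (M * h) ^ 2 / 2 := by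
      rw [Complex.norm_real, Real.norm_eq_abs, abs_div, abs_mul, abs_of_nonneg (sq_nonneg h),
        abs_of_pos (by norm_num : (0 : ℝ) < 2)]
      have := mul_le_mul_of_nonneg_left (hG j h0) (sq_nonneg h)
      nlinarith
    refine (norm_sub_le _ _).trans ?_
    rw [norm_mul]
    have h6 : ‖Complex.exp (Complex.I * ((h * D j : ℝ) : ℂ)) - 1‖ *
        ‖((h ^ 2 * G j / 2 : ℝ) : ℂ)‖ ≤ (2 * (M * h) ^ δ) * ((M * h) ^ 2 / 2) :=
      mul_le_mul (h2.trans (by linarith)) h5 (norm_nonneg _) (by positivity)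
    have h7 : (2 * (M * h) ^ δ) * ((M * h) ^ 2 / 2) = (M * h) ^ (2 + δ) := by
      rw [hMsplit]; ring
    linarith
  have hlast : ‖((v * h ^ 4 * G₀ / 4 : ℝ) : ℂ)‖ ≤ v * (M * h) ^ (2 + δ) := by
    rw [Complex.norm_real, Real.norm_eq_abs, abs_div, abs_mul,
      abs_of_nonneg (by positivity : 0 ≤ v * h ^ 4), abs_of_pos (by norm_num : (0 : ℝ) < 4)]
    have h1 : h ^ 2 ≤ (M * h) ^ δ := by
      have ha : h ≤ (M * h) ^ δ := by
        calc h ≤ h ^ δ := Real.self_le_rpow_of_le_one hh0 hh1 hδ1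
          _ ≤ (M * h) ^ δ := Real.rpow_le_rpow hh0 (by nlinarith) hδ0
      nlinarith
    rw [hMsplit]
    have h2 : h ^ 2 * (M * h) ^ 2 ≤ (M * h) ^ 2 * (M * h) ^ δ := by
      rw [mul_comm]
      exact mul_le_mul_of_nonneg_left h1 (sq_nonneg _)
    have h3 : v * h ^ 4 * |G₀| ≤ v * h ^ 4 * M ^ 2 :=
      mul_le_mul_of_nonneg_left hG₀ (by positivity)
    have h4 : v * h ^ 4 * M ^ 2 = v * (h ^ 2 * (M * h) ^ 2) := by ring
    have h5 := mul_le_mul_of_nonneg_left h2 hv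
    have h6 : 0 ≤ v * h ^ 4 * |G₀| := by positivity
    linarith
  rw [hsplit]
  refine (norm_sub_le _ _).trans ?_
  have hs : ‖∑ j, p j • err j‖ ≤ 5 * (M * h) ^ (2 + δ) := by
    refine (norm_sum_le _ _).trans ((Finset.sum_le_sum fun j _ => herr_le j).trans ?_)
    rw [← Finset.sum_mul, hp1, one_mul]
  linarith

lemma norm_sub_pow_mul_le {u : ℕ → ℂ} {r : ℂ} {η : ℝ} (hr : ‖r‖ ≤ 1)
    (h : ∀ n, ‖u (n + 1) - r * u n‖ ≤ η) (n : ℕ) : ‖u n - r ^ n * u 0‖ ≤ n * η := by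
  induction n with
  | zero => simp
  | succ n ih =>
    have e : u (n + 1) - r ^ (n + 1) * u 0 = (u (n + 1) - r * u n) + r * (u n - r ^ n * u 0) := by
      ring
    rw [e]
    refine (norm_add_le _ _).trans ?_
    rw [norm_mul]
    have h2 : ‖r‖ * ‖u n - r ^ n * u 0‖ ≤ 1 * (n * η) :=
      mul_le_mul hr ih (norm_nonneg _) zero_le_one
    push_cast
    linarith [h n]

section Limit

variable {d : ℕ} {S : Type*} {τ : Fin d → Fin d → S → S} {s₀ : S}
  {Ω : Type*} [MeasurableSpace Ω] {μ : Measure Ω} [IsProbabilityMeasure μ]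
  {P : Matrix (Fin d) (Fin d) ℝ} {X : ℕ → Ω → Fin d}

/-- Quantitative form of the central limit theorem: the characteristic function of `h` times a
sum of `K` martingale increments, compared with that of a normal law of variance `K h² v`. -/
lemma IsMarkovChain.norm_charFun_pathSum_sub_le (hX : IsMarkovChain μ P X)
    (hP : P ∈ Matrix.rowStochastic ℝ (Fin d)) {D : Fin d → S → Fin d → ℝ} {G N : Fin d → S → ℝ}
    {v δ B h : ℝ} (hδ0 : 0 ≤ δ) (hδ1 : δ ≤ 1) (hv : 0 ≤ v) (hN : ∀ i s, 1 ≤ N i s)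
    (hmean : ∀ i s, ∑ j, P i j * D i s j = 0)
    (hvar : ∀ i s, ∑ j, P i j * D i s j ^ 2 = v + G i s - transOp P τ G i s)
    (hD : ∀ i s j, 0 < P i j → |D i s j| ≤ N i s)
    (hG' : ∀ i s j, 0 < P i j → |G j (τ i j s)| ≤ N i s ^ 2) (hG : ∀ i s, |G i s| ≤ N i s ^ 2)
    (hB : ∀ n, ∫ ω, N (X n ω) (pathState τ s₀ (fun k => X k ω) n) ^ (2 + δ) ∂μ ≤ B)
    (hh0 : 0 ≤ h) (hh1 : h ≤ 1) (hvh : v * h ^ 2 ≤ 2) (K : ℕ) :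
    ‖∫ ω, Complex.exp (Complex.I *
          ((h * pathSum τ s₀ D (fun k => X k ω) K : ℝ) : ℂ)) ∂μ -
        ((1 - v * h ^ 2 / 2 : ℝ) : ℂ) ^ K‖ ≤
      K * ((5 + v) * B * h ^ (2 + δ)) + 2 * (h ^ 2 * B) := by
  set r : ℂ := ((1 - v * h ^ 2 / 2 : ℝ) : ℂ) with hrdef
  have hr : ‖r‖ ≤ 1 := by
    rw [hrdef, Complex.norm_real, Real.norm_eq_abs, abs_le]
    constructor <;> nlinarith [mul_nonneg hv (sq_nonneg h)]
  have hint := fun n (ψ : Fin d → S → ℝ → ℂ) =>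
    hX.integrable_state (τ := τ) (s₀ := s₀) D n ψ
  have hintR := fun n (ψ : Fin d → S → ℝ → ℝ) =>
    hX.integrable_state (τ := τ) (s₀ := s₀) D n ψ
  set u : ℕ → ℂ := fun n => ∫ ω, Complex.exp (Complex.I *
      ((h * pathSum τ s₀ D (fun k => X k ω) n : ℝ) : ℂ)) *
      (1 - ((h ^ 2 * G (X n ω) (pathState τ s₀ (fun k => X k ω) n) / 2 : ℝ) : ℂ)) ∂μ with hu
  have hexp : ∀ y : ℝ, ‖Complex.exp (Complex.I * (y : ℂ))‖ = 1 := fun y => by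
    rw [mul_comm, Complex.norm_exp_ofReal_mul_I]
  -- the recursion for the corrected characteristic function
  have hstep : ∀ n, ‖u (n + 1) - r * u n‖ ≤ (5 + v) * B * h ^ (2 + δ) := by
    intro n
    have h1 := hX.integral_state_succ (τ := τ) (s₀ := s₀) D n fun j s t =>
      Complex.exp (Complex.I * ((h * t : ℝ) : ℂ)) * (1 - ((h ^ 2 * G j s / 2 : ℝ) : ℂ))
    have e : u (n + 1) - r * u n = ∫ ω, (fun i s t => ((∑ j, P i j •
        (Complex.exp (Complex.I * ((h * (t + D i s j) : ℝ) : ℂ)) *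
          (1 - ((h ^ 2 * G j (τ i j s) / 2 : ℝ) : ℂ)))) -
        r * (Complex.exp (Complex.I * ((h * t : ℝ) : ℂ)) *
          (1 - ((h ^ 2 * G i s / 2 : ℝ) : ℂ)))))
        (X n ω) (pathState τ s₀ (fun k => X k ω) n) (pathSum τ s₀ D (fun k => X k ω) n) ∂μ := by
      simp only [hu]
      rw [h1, ← integral_const_mul, ← integral_sub]
      · exact hint n fun i s t => ∑ j, P i j •
          (Complex.exp (Complex.I * ((h * (t + D i s j) : ℝ) : ℂ)) *
            (1 - ((h ^ 2 * G j (τ i j s) / 2 : ℝ) : ℂ)))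
      · exact hint n fun i s t => r * (Complex.exp (Complex.I * ((h * t : ℝ) : ℂ)) *
            (1 - ((h ^ 2 * G i s / 2 : ℝ) : ℂ)))
    rw [e]
    have hbound : ∀ i s t, ‖(∑ j, P i j •
        (Complex.exp (Complex.I * ((h * (t + D i s j) : ℝ) : ℂ)) *
          (1 - ((h ^ 2 * G j (τ i j s) / 2 : ℝ) : ℂ)))) -
        r * (Complex.exp (Complex.I * ((h * t : ℝ) : ℂ)) *
          (1 - ((h ^ 2 * G i s / 2 : ℝ) : ℂ)))‖ ≤ (5 + v) * h ^ (2 + δ) * N i s ^ (2 + δ) := by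
      intro i s t
      have h2 := norm_charFun_step_le (p := P i) (D := D i s) (G := fun j => G j (τ i j s))
        (G₀ := G i s) (M := N i s) (fun j => Matrix.nonneg_of_mem_rowStochastic hP)
        (Matrix.sum_row_of_mem_rowStochastic hP i) hδ0 hδ1 hv hh0 hh1 (hN i s) (hmean i s)
        (hvar i s) (hD i s) (hG' i s) (hG i s)
      have e2 : (∑ j, P i j •
          (Complex.exp (Complex.I * ((h * (t + D i s j) : ℝ) : ℂ)) *
            (1 - ((h ^ 2 * G j (τ i j s) / 2 : ℝ) : ℂ)))) -
          r * (Complex.exp (Complex.I * ((h * t : ℝ) : ℂ)) *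
            (1 - ((h ^ 2 * G i s / 2 : ℝ) : ℂ))) =
          Complex.exp (Complex.I * ((h * t : ℝ) : ℂ)) *
          (∑ j, P i j • (Complex.exp (Complex.I * ((h * D i s j : ℝ) : ℂ)) *
            (1 - ((h ^ 2 * G j (τ i j s) / 2 : ℝ) : ℂ))) -
            r * (1 - ((h ^ 2 * G i s / 2 : ℝ) : ℂ))) := by
        refine Eq.trans ?_ (mul_sub _ _ _).symm
        rw [Finset.mul_sum]
        congr 1
        · refine Finset.sum_congr rfl fun j _ => ?_
          rw [mul_add h, Complex.ofReal_add, mul_add, Complex.exp_add, mul_smul_comm, mul_assoc]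
        · ring
      rw [e2, norm_mul, hexp, one_mul]
      refine h2.trans (le_of_eq ?_)
      rw [Real.mul_rpow (by linarith [hN i s]) hh0]
      ring
    refine (norm_integral_le_of_norm_le
      (hintR n fun i s _ => (5 + v) * h ^ (2 + δ) * N i s ^ (2 + δ))
      (ae_of_all _ fun ω => hbound _ _ _)).trans ?_
    rw [integral_const_mul]
    have := mul_le_mul_of_nonneg_left (hB n)
      (mul_nonneg (by linarith : 0 ≤ 5 + v) (Real.rpow_nonneg hh0 (2 + δ)))
    linarith
  -- the corrector is negligible
  have hcorr : ∀ n, ‖u n - ∫ ω, Complex.exp (Complex.I *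
      ((h * pathSum τ s₀ D (fun k => X k ω) n : ℝ) : ℂ)) ∂μ‖ ≤ h ^ 2 * B := by
    intro n
    simp only [hu]
    rw [← integral_sub]
    rotate_left
    · exact hint n fun i s t => Complex.exp (Complex.I * ((h * t : ℝ) : ℂ)) *
          (1 - ((h ^ 2 * G i s / 2 : ℝ) : ℂ))
    · exact hint n fun i s t => Complex.exp (Complex.I * ((h * t : ℝ) : ℂ))
    have hbound : ∀ i s t, ‖Complex.exp (Complex.I * ((h * t : ℝ) : ℂ)) *
          (1 - ((h ^ 2 * G i s / 2 : ℝ) : ℂ)) - Complex.exp (Complex.I * ((h * t : ℝ) : ℂ))‖ ≤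
          h ^ 2 * N i s ^ (2 + δ) := by
      intro i s t
      have e : Complex.exp (Complex.I * ((h * t : ℝ) : ℂ)) *
          (1 - ((h ^ 2 * G i s / 2 : ℝ) : ℂ)) - Complex.exp (Complex.I * ((h * t : ℝ) : ℂ)) =
          -(Complex.exp (Complex.I * ((h * t : ℝ) : ℂ)) * ((h ^ 2 * G i s / 2 : ℝ) : ℂ)) := by
        ring
      rw [e, norm_neg, norm_mul, hexp, one_mul, Complex.norm_real, Real.norm_eq_abs, abs_div,
        abs_mul, abs_of_nonneg (sq_nonneg h), abs_of_pos (by norm_num : (0 : ℝ) < 2)]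
      have h2 : N i s ^ (2 : ℕ) ≤ N i s ^ (2 + δ) := by
        rw [← Real.rpow_natCast]
        exact Real.rpow_le_rpow_of_exponent_le (hN i s) (by push_cast; linarith)
      have h3 := mul_le_mul_of_nonneg_left ((hG i s).trans h2) (sq_nonneg h)
      have h4 : 0 ≤ h ^ 2 * |G i s| := by positivity
      linarith
    refine (norm_integral_le_of_norm_le (hintR n fun i s _ => h ^ 2 * N i s ^ (2 + δ))
      (ae_of_all _ fun ω => hbound _ _ _)).trans ?_
    rw [integral_const_mul]
    exact mul_le_mul_of_nonneg_left (hB n) (sq_nonneg h)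
  have h0 := hcorr 0
  simp only [pathSum, Finset.range_zero, Finset.sum_empty, mul_zero, Complex.ofReal_zero,
    Complex.exp_zero, integral_const, probReal_univ, one_smul] at h0
  have hK := norm_sub_pow_mul_le hr hstep K
  have e : ∫ ω, Complex.exp (Complex.I *
          ((h * pathSum τ s₀ D (fun k => X k ω) K : ℝ) : ℂ)) ∂μ - r ^ K =
      (u K - r ^ K * u 0) + (r ^ K * (u 0 - 1) - (u K - ∫ ω, Complex.exp (Complex.I *
          ((h * pathSum τ s₀ D (fun k => X k ω) K : ℝ) : ℂ)) ∂μ)) := by ring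
  rw [e]
  refine (norm_add_le _ _).trans (add_le_add hK ((norm_sub_le _ _).trans ?_))
  rw [norm_mul, norm_pow]
  have h5 : ‖r‖ ^ K * ‖u 0 - 1‖ ≤ 1 * (h ^ 2 * B) :=
    mul_le_mul (pow_le_one₀ (norm_nonneg _) hr) h0 (norm_nonneg _) zero_le_one
  linarith [hcorr K]

/-- The central limit theorem for a sum of martingale increments `D` whose conditional variance
is constant up to a coboundary, in terms of characteristic functions. -/
lemma IsMarkovChain.tendsto_charFun_pathSum (hX : IsMarkovChain μ P X)
    (hP : P ∈ Matrix.rowStochastic ℝ (Fin d)) {D : Fin d → S → Fin d → ℝ} {G N : Fin d → S → ℝ}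
    {v δ B : ℝ} (hδ0 : 0 < δ) (hδ1 : δ ≤ 1) (hv : 0 ≤ v) (hN : ∀ i s, 1 ≤ N i s)
    (hmean : ∀ i s, ∑ j, P i j * D i s j = 0)
    (hvar : ∀ i s, ∑ j, P i j * D i s j ^ 2 = v + G i s - transOp P τ G i s)
    (hD : ∀ i s j, 0 < P i j → |D i s j| ≤ N i s)
    (hG' : ∀ i s j, 0 < P i j → |G j (τ i j s)| ≤ N i s ^ 2) (hG : ∀ i s, |G i s| ≤ N i s ^ 2)
    (hB : ∀ n, ∫ ω, N (X n ω) (pathState τ s₀ (fun k => X k ω) n) ^ (2 + δ) ∂μ ≤ B) :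
    Tendsto (fun K : ℕ => ∫ ω, Complex.exp (Complex.I *
        (((√(K : ℝ))⁻¹ * pathSum τ s₀ D (fun k => X k ω) K : ℝ) : ℂ)) ∂μ) atTop
      (𝓝 (Complex.exp (-(v / 2 : ℝ)))) := by
  have hlim : Tendsto (fun K : ℕ => (((1 + -(v / 2) / (K : ℝ)) ^ K : ℝ) : ℂ)) atTop
      (𝓝 (Complex.exp (-(v / 2 : ℝ)))) := by
    rw [← Complex.ofReal_neg, ← Complex.ofReal_exp]
    exact (Complex.continuous_ofReal.tendsto _).comp
      ((Real.tendsto_one_add_div_pow_exp (-(v / 2))))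
  have herr : Tendsto (fun K : ℕ => (5 + v) * B * (√(K : ℝ))⁻¹ ^ δ +
      2 * ((√(K : ℝ))⁻¹ ^ 2 * B)) atTop (𝓝 0) := by
    have h1 : Tendsto (fun K : ℕ => (√(K : ℝ))⁻¹) atTop (𝓝 0) :=
      tendsto_inv_atTop_zero.comp (Real.tendsto_sqrt_atTop.comp tendsto_natCast_atTop_atTop)
    have h2 := h1.rpow_const (p := δ) (Or.inr hδ0.le)
    rw [Real.zero_rpow hδ0.ne'] at h2
    have h3 := (h2.const_mul ((5 + v) * B)).add (((h1.pow 2).mul_const B).const_mul 2)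
    simpa using h3
  have hdiff : Tendsto (fun K : ℕ => ∫ ω, Complex.exp (Complex.I *
        (((√(K : ℝ))⁻¹ * pathSum τ s₀ D (fun k => X k ω) K : ℝ) : ℂ)) ∂μ -
        (((1 + -(v / 2) / (K : ℝ)) ^ K : ℝ) : ℂ)) atTop (𝓝 0) := by
    refine squeeze_zero_norm' ?_ herr
    obtain ⟨K₀, hK₀⟩ := exists_nat_ge v
    filter_upwards [eventually_ge_atTop (max 1 K₀)] with K hK
    have hK1 : 1 ≤ K := (le_max_left _ _).trans hK
    have hKv : v ≤ K := hK₀.trans (by exact_mod_cast (le_max_right _ _).trans hK)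
    have hKpos : (0 : ℝ) < K := by exact_mod_cast hK1
    have hs1 : 1 ≤ √(K : ℝ) := by
      rw [Real.one_le_sqrt]
      exact_mod_cast hK1
    have hsq : (√(K : ℝ))⁻¹ ^ 2 = (K : ℝ)⁻¹ := by
      rw [inv_pow, Real.sq_sqrt hKpos.le]
    have hh0 : 0 < (√(K : ℝ))⁻¹ := by positivity
    have hvh : v * (√(K : ℝ))⁻¹ ^ 2 ≤ 2 := by
      rw [hsq, ← div_eq_mul_inv, div_le_iff₀ hKpos]
      linarith
    have h := hX.norm_charFun_pathSum_sub_le hP hδ0.le hδ1 hv hN hmean hvar hD hG' hG hB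
      hh0.le (inv_le_one_of_one_le₀ hs1) hvh K
    have e1 : (1 - v * (√(K : ℝ))⁻¹ ^ 2 / 2) = 1 + -(v / 2) / (K : ℝ) := by
      rw [hsq]
      ring
    have e2 : (K : ℝ) * ((5 + v) * B * (√(K : ℝ))⁻¹ ^ (2 + δ)) =
        (5 + v) * B * (√(K : ℝ))⁻¹ ^ δ := by
      rw [Real.rpow_add hh0, Real.rpow_two, hsq]
      field_simp
    rw [e1, e2, ← Complex.ofReal_pow] at h
    exact h
  simpa using hdiff.add hlim

/-! ### The strong law for martingales with bounded increments -/

lemma IsMarkovChain.integral_pathSum_sq_le (hX : IsMarkovChain μ P X)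
    (hP : P ∈ Matrix.rowStochastic ℝ (Fin d)) {D : Fin d → S → Fin d → ℝ} {b : ℝ}
    (hmean : ∀ i s, ∑ j, P i j * D i s j = 0) (hD : ∀ i s j, |D i s j| ≤ b) (n : ℕ) :
    ∫ ω, pathSum τ s₀ D (fun k => X k ω) n ^ 2 ∂μ ≤ b ^ 2 * n := by
  have hint := fun n (ψ : Fin d → S → ℝ → ℝ) => hX.integrable_state (τ := τ) (s₀ := s₀) D n ψ
  induction n with
  | zero => simp [pathSum]
  | succ n ih =>
    have h := hX.integral_state_succ (τ := τ) (s₀ := s₀) D n fun _ _ t => t ^ 2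
    rw [h]
    have hb : ∀ i s t, ∑ j, P i j • (t + D i s j) ^ 2 ≤ t ^ 2 + b ^ 2 := by
      intro i s t
      have e : ∀ j, P i j • (t + D i s j) ^ 2 =
          P i j * t ^ 2 + 2 * t * (P i j * D i s j) + P i j * D i s j ^ 2 := fun j => by
        rw [smul_eq_mul]; ring
      simp only [e]
      rw [Finset.sum_add_distrib, Finset.sum_add_distrib, ← Finset.mul_sum, hmean,
        ← Finset.sum_mul, Matrix.sum_row_of_mem_rowStochastic hP]
      have h2 : ∑ j, P i j * D i s j ^ 2 ≤ ∑ j, P i j * b ^ 2 :=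
        Finset.sum_le_sum fun j _ => mul_le_mul_of_nonneg_left
          (sq_le_sq' (neg_le_of_abs_le (hD i s j)) (le_of_abs_le (hD i s j)))
          (Matrix.nonneg_of_mem_rowStochastic hP)
      rw [← Finset.sum_mul, Matrix.sum_row_of_mem_rowStochastic hP] at h2
      linarith
    calc _ ≤ ∫ ω, (pathSum τ s₀ D (fun k => X k ω) n ^ 2 + b ^ 2) ∂μ :=
          integral_mono (hint n fun i s t => ∑ j, P i j • (t + D i s j) ^ 2)
            (hint n fun _ _ t => t ^ 2 + b ^ 2) fun ω => hb _ _ _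
      _ = ∫ ω, pathSum τ s₀ D (fun k => X k ω) n ^ 2 ∂μ + b ^ 2 := by
          rw [integral_add (hint n fun _ _ t => t ^ 2) (integrable_const _)]
          simp
      _ ≤ _ := by push_cast; linarith

lemma IsMarkovChain.integral_pathSum_pow_four_le (hX : IsMarkovChain μ P X)
    (hP : P ∈ Matrix.rowStochastic ℝ (Fin d)) {D : Fin d → S → Fin d → ℝ} {b : ℝ}
    (hmean : ∀ i s, ∑ j, P i j * D i s j = 0) (hD : ∀ i s j, |D i s j| ≤ b) (n : ℕ) :
    ∫ ω, pathSum τ s₀ D (fun k => X k ω) n ^ 4 ∂μ ≤ 11 * b ^ 4 * (n : ℝ) ^ 2 := by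
  have hint := fun n (ψ : Fin d → S → ℝ → ℝ) => hX.integrable_state (τ := τ) (s₀ := s₀) D n ψ
  induction n with
  | zero => simp [pathSum]
  | succ n ih =>
    have h := hX.integral_state_succ (τ := τ) (s₀ := s₀) D n fun _ _ t => t ^ 4
    rw [h]
    have hb : ∀ i s t, ∑ j, P i j • (t + D i s j) ^ 4 ≤ t ^ 4 + (8 * b ^ 2 * t ^ 2 + 3 * b ^ 4) := by
      intro i s t
      have e : ∀ j, P i j • (t + D i s j) ^ 4 ≤
          P i j * (t ^ 4 + (8 * b ^ 2 * t ^ 2 + 3 * b ^ 4)) +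
            4 * t ^ 3 * (P i j * D i s j) := fun j => by
        rw [smul_eq_mul]
        have hp : 0 ≤ P i j := Matrix.nonneg_of_mem_rowStochastic hP
        have hx2 : D i s j ^ 2 ≤ b ^ 2 :=
          sq_le_sq' (neg_le_of_abs_le (hD i s j)) (le_of_abs_le (hD i s j))
        have hx4 : D i s j ^ 4 ≤ b ^ 4 := by nlinarith [sq_nonneg (D i s j), sq_nonneg b]
        have h1 : t ^ 2 * D i s j ^ 2 ≤ t ^ 2 * b ^ 2 :=
          mul_le_mul_of_nonneg_left hx2 (sq_nonneg t)
        have h2 : 4 * t * D i s j ^ 3 ≤ 2 * (t ^ 2 * D i s j ^ 2) + 2 * D i s j ^ 4 := by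
          nlinarith [sq_nonneg (t * D i s j - D i s j ^ 2)]
        have key : (t + D i s j) ^ 4 ≤
            t ^ 4 + (8 * b ^ 2 * t ^ 2 + 3 * b ^ 4) + 4 * t ^ 3 * D i s j := by
          have : (t + D i s j) ^ 4 = t ^ 4 + 4 * t ^ 3 * D i s j + 6 * (t ^ 2 * D i s j ^ 2)
            + 4 * t * D i s j ^ 3 + D i s j ^ 4 := by ring
          linarith
        have := mul_le_mul_of_nonneg_left key hp
        linarith
      refine (Finset.sum_le_sum fun j _ => e j).trans ?_
      rw [Finset.sum_add_distrib, ← Finset.mul_sum, hmean, ← Finset.sum_mul,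
        Matrix.sum_row_of_mem_rowStochastic hP]
      linarith
    have h2 := hX.integral_pathSum_sq_le (τ := τ) (s₀ := s₀) hP hmean hD n
    calc _ ≤ ∫ ω, (pathSum τ s₀ D (fun k => X k ω) n ^ 4 +
            (8 * b ^ 2 * pathSum τ s₀ D (fun k => X k ω) n ^ 2 + 3 * b ^ 4)) ∂μ :=
          integral_mono (hint n fun i s t => ∑ j, P i j • (t + D i s j) ^ 4)
            (hint n fun _ _ t => t ^ 4 + (8 * b ^ 2 * t ^ 2 + 3 * b ^ 4)) fun ω => hb _ _ _
      _ = ∫ ω, pathSum τ s₀ D (fun k => X k ω) n ^ 4 ∂μ +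
            (8 * b ^ 2 * ∫ ω, pathSum τ s₀ D (fun k => X k ω) n ^ 2 ∂μ + 3 * b ^ 4) := by
          rw [integral_add (hint n fun _ _ t => t ^ 4)
            (hint n fun _ _ t => 8 * b ^ 2 * t ^ 2 + 3 * b ^ 4),
            integral_add (hint n fun _ _ t => 8 * b ^ 2 * t ^ 2) (integrable_const _),
            integral_const_mul]
          simp
      _ ≤ _ := by
          have h3 := mul_le_mul_of_nonneg_left h2 (by positivity : 0 ≤ 8 * b ^ 2)
          have h4 : 0 ≤ b ^ 4 * (n : ℝ) := by positivity
          have h5 : 0 ≤ b ^ 4 := by positivity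
          push_cast
          nlinarith

/-- Strong law: a sum of bounded martingale increments is almost surely of smaller order than
the number of its terms. -/
lemma IsMarkovChain.ae_tendsto_pathSum_div (hX : IsMarkovChain μ P X)
    (hP : P ∈ Matrix.rowStochastic ℝ (Fin d)) {D : Fin d → S → Fin d → ℝ} {b : ℝ}
    (hmean : ∀ i s, ∑ j, P i j * D i s j = 0) (hD : ∀ i s j, |D i s j| ≤ b) :
    ∀ᵐ ω ∂μ, Tendsto (fun n : ℕ => pathSum τ s₀ D (fun k => X k ω) n / n) atTop (𝓝 0) := by
  have hmeas : ∀ n : ℕ, Measurable fun ω =>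
      ENNReal.ofReal ((pathSum τ s₀ D (fun k => X k ω) n / n) ^ 4) := fun n =>
    hX.measurable_comp (dependsOn_state (τ := τ) (s₀ := s₀) D n
      fun _ _ t => ENNReal.ofReal ((t / n) ^ 4))
  have hle : ∀ n : ℕ, ∫⁻ ω, ENNReal.ofReal ((pathSum τ s₀ D (fun k => X k ω) n / n) ^ 4) ∂μ ≤
      ENNReal.ofReal (11 * b ^ 4 * (1 / (n : ℝ) ^ 2)) := by
    intro n
    have hint : Integrable (fun ω => (pathSum τ s₀ D (fun k => X k ω) n / n) ^ 4) μ :=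
      hX.integrable_state (τ := τ) (s₀ := s₀) D n fun _ _ t => (t / n) ^ 4
    rw [← ofReal_integral_eq_lintegral_ofReal hint (ae_of_all _ fun ω => by positivity)]
    refine ENNReal.ofReal_le_ofReal ?_
    simp only [div_pow]
    rw [integral_div]
    rcases Nat.eq_zero_or_pos n with rfl | hn
    · simp
    have hn' : (0 : ℝ) < n := by exact_mod_cast hn
    rw [div_le_iff₀ (by positivity)]
    refine (hX.integral_pathSum_pow_four_le (τ := τ) (s₀ := s₀) hP hmean hD n).trans
      (le_of_eq ?_)
    field_simp
  have hsum : ∫⁻ ω, ∑' n : ℕ,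
      ENNReal.ofReal ((pathSum τ s₀ D (fun k => X k ω) n / n) ^ 4) ∂μ ≠ ∞ := by
    rw [lintegral_tsum fun n => (hmeas n).aemeasurable]
    refine ne_top_of_le_ne_top ?_ (ENNReal.tsum_le_tsum hle)
    have hs : Summable fun n : ℕ => 11 * b ^ 4 * (1 / (n : ℝ) ^ 2) :=
      (Real.summable_one_div_nat_pow.2 (by norm_num)).mul_left _
    rw [← ENNReal.ofReal_tsum_of_nonneg (fun n => by positivity) hs]
    exact ENNReal.ofReal_ne_top
  filter_upwards [ae_lt_top (Measurable.tsum hmeas) hsum] with ω hω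
  have h1 := ENNReal.tendsto_atTop_zero_of_tsum_ne_top hω.ne
  have h2 : Tendsto (fun n : ℕ => (pathSum τ s₀ D (fun k => X k ω) n / n) ^ 4) atTop (𝓝 0) := by
    have h3 := (ENNReal.tendsto_toReal (ENNReal.zero_ne_top)).comp h1
    refine h3.congr fun n => ?_
    simp only [Function.comp]
    rw [ENNReal.toReal_ofReal (by positivity)]
  have h3 : Tendsto (fun n : ℕ => |pathSum τ s₀ D (fun k => X k ω) n / n|) atTop (𝓝 0) := by
    have h4 := h2.sqrt.sqrt
    simp only [Real.sqrt_zero] at h4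
    refine h4.congr fun n => ?_
    rw [show ∀ y : ℝ, y ^ 4 = (y ^ 2) ^ 2 from fun y => by ring, Real.sqrt_sq (sq_nonneg _),
      Real.sqrt_sq_eq_abs]
  exact (tendsto_zero_iff_abs_tendsto_zero _).2 h3

end Limit

/-! ### Subinvariant vectors of nonnegative matrices -/

/-- The nonnegative matrix `B` shrinks the weight vector `u ≥ 1` by the factor `β < 1`; in other
words `B` is a contraction for the sup norm weighted by `u`. -/
structure IsSubinvariant {d : ℕ} (B : Matrix (Fin d) (Fin d) ℝ) (u : Fin d → ℝ) (β : ℝ) :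
    Prop where
  nonneg : ∀ i j, 0 ≤ B i j
  one_le : ∀ i, 1 ≤ u i
  rate_nonneg : 0 ≤ β
  rate_lt_one : β < 1
  sum_le : ∀ i, ∑ j, B i j * u j ≤ β * u i

section Subinvariant

variable {d : ℕ} {B : Matrix (Fin d) (Fin d) ℝ} {u : Fin d → ℝ} {β : ℝ}

lemma IsSubinvariant.pos (h : IsSubinvariant B u β) (i : Fin d) : 0 < u i :=
  zero_lt_one.trans_le (h.one_le i)

lemma IsSubinvariant.nonpos_of_le_sum (h : IsSubinvariant B u β) {y : Fin d → ℝ}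
    (hy : ∀ i, y i ≤ ∑ j, B i j * y j) (i : Fin d) : y i ≤ 0 := by
  obtain ⟨x, -, hx⟩ := Finset.exists_max_image Finset.univ (fun i => y i / u i)
    ⟨i, Finset.mem_univ i⟩
  by_contra! hcon
  have hm : 0 < y x / u x := (div_pos hcon (h.pos i)).trans_le (hx i (Finset.mem_univ i))
  have h1 : ∀ j, y j ≤ y x / u x * u j := fun j =>
    (div_le_iff₀ (h.pos j)).1 (hx j (Finset.mem_univ j))
  have h2 : y x ≤ y x / u x * (β * u x) :=
    calc y x ≤ ∑ j, B x j * y j := hy x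
      _ ≤ ∑ j, B x j * (y x / u x * u j) :=
          Finset.sum_le_sum fun j _ => mul_le_mul_of_nonneg_left (h1 j) (h.nonneg x j)
      _ = y x / u x * ∑ j, B x j * u j := by
          rw [Finset.mul_sum]
          exact Finset.sum_congr rfl fun j _ => by ring
      _ ≤ _ := mul_le_mul_of_nonneg_left (h.sum_le x) hm.le
  have h3 : y x / u x * u x = y x := div_mul_cancel₀ _ (h.pos x).ne'
  have h4 : 0 < y x := by rw [← h3]; exact mul_pos hm (h.pos x)
  nlinarith [h.rate_lt_one]

lemma IsSubinvariant.eq_zero_of_abs_le_sum (h : IsSubinvariant B u β) {y : Fin d → ℝ}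
    (hy : ∀ i, |y i| ≤ ∑ j, B i j * |y j|) : y = 0 := by
  funext i
  exact abs_nonpos_iff.1 (h.nonpos_of_le_sum (y := fun i => |y i|) hy i)

/-- A linear recursion along the transitions of a system with finitely many states is uniquely
solvable as soon as its coefficients are dominated by a subinvariant matrix. -/
lemma IsSubinvariant.exists_sub_sum_eq (h : IsSubinvariant B u β) {σ : Type*} [Finite σ]
    (τ : Fin d → Fin d → σ → σ) {b : Matrix (Fin d) (Fin d) ℝ} (hb : ∀ i j, |b i j| ≤ B i j)
    (f : Fin d → σ → ℝ) :
    ∃ g : Fin d → σ → ℝ, ∀ i s, g i s - ∑ j, b i j * g j (τ i j s) = f i s := by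
  have := Fintype.ofFinite σ
  let L : (Fin d → σ → ℝ) →ₗ[ℝ] (Fin d → σ → ℝ) :=
    { toFun := fun g i s => g i s - ∑ j, b i j * g j (τ i j s)
      map_add' := fun g g' => by
        funext i s
        simp only [Pi.add_apply, mul_add, Finset.sum_add_distrib]
        ring
      map_smul' := fun c g => by
        funext i s
        simp only [Pi.smul_apply, smul_eq_mul, RingHom.id_apply, mul_sub, Finset.mul_sum]
        congr 1
        exact Finset.sum_congr rfl fun j _ => by ring }
  have hinj : Function.Injective L := by
    rw [injective_iff_map_eq_zero]
    intro g hg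
    have hg' : ∀ i s, g i s = ∑ j, b i j * g j (τ i j s) := fun i s =>
      sub_eq_zero.1 (congrFun (congrFun hg i) s)
    rcases isEmpty_or_nonempty σ with hσ | hσ
    · funext i s
      exact hσ.elim s
    have key := h.nonpos_of_le_sum
      (y := fun i => Finset.univ.sup' Finset.univ_nonempty fun s => |g i s|) fun i => by
        refine Finset.sup'_le _ _ fun s _ => ?_
        rw [hg' i s]
        refine (Finset.abs_sum_le_sum_abs _ _).trans (Finset.sum_le_sum fun j _ => ?_)
        rw [abs_mul]
        exact mul_le_mul (hb i j)
          (Finset.le_sup' (fun s => |g j s|) (Finset.mem_univ _)) (abs_nonneg _) (h.nonneg i j)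
    funext i s
    exact abs_nonpos_iff.1
      ((Finset.le_sup' (fun s => |g i s|) (Finset.mem_univ s)).trans (key i))
  obtain ⟨g, hg⟩ := LinearMap.injective_iff_surjective.1 hinj f
  exact ⟨g, fun i s => congrFun (congrFun hg i) s⟩

end Subinvariant

section Gelfand

attribute [local instance] Matrix.linftyOpNormedRing Matrix.linftyOpNormedAlgebra

/-- By Gelfand's formula the row sums of the powers of a matrix of spectral radius less than `1`
are summable. -/
lemma summable_pow_mulVec_one {d : ℕ} {B : Matrix (Fin d) (Fin d) ℝ} (hB : specRad B < 1)
    (i : Fin d) : Summable fun n : ℕ => ((B ^ n).mulVec 1) i := by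
  set M : Matrix (Fin d) (Fin d) ℂ := B.map ((↑) : ℝ → ℂ) with hM
  have hpow : ∀ n, M ^ n = (B ^ n).map ((↑) : ℝ → ℂ) := fun n =>
    (map_pow (Complex.ofRealHom.mapMatrix) B n).symm
  obtain ⟨r, hr1, hr2⟩ := ENNReal.lt_iff_exists_nnreal_btwn.1 hB
  have hr2' : (r : ℝ) < 1 := by exact_mod_cast hr2
  have hG := spectrum.pow_nnnorm_pow_one_div_tendsto_nhds_spectralRadius M
  have hev : ∀ᶠ n : ℕ in atTop, ‖((B ^ n).mulVec 1) i‖ ≤ (r : ℝ) ^ n := by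
    filter_upwards [hG.eventually_lt_const hr1, eventually_gt_atTop 0] with n hn hn0
    have hn0' : (0 : ℝ) < n := by exact_mod_cast hn0
    have h1 : (‖M ^ n‖₊ : ℝ≥0∞) ≤ (r : ℝ≥0∞) ^ n := by
      have h2 := ENNReal.rpow_le_rpow hn.le hn0'.le
      rwa [← ENNReal.rpow_mul, one_div, inv_mul_cancel₀ hn0'.ne', ENNReal.rpow_one,
        ENNReal.rpow_natCast] at h2
    have h3 : ‖M ^ n‖₊ ≤ r ^ n := by exact_mod_cast h1
    have h4 : ∑ j, ‖(M ^ n) i j‖₊ ≤ ‖M ^ n‖₊ := by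
      rw [Matrix.linfty_opNNNorm_def]
      exact Finset.le_sup (f := fun i => ∑ j, ‖(M ^ n) i j‖₊) (Finset.mem_univ i)
    have h5 : ((∑ j, ‖(M ^ n) i j‖₊ : NNReal) : ℝ) ≤ (r : ℝ) ^ n := by
      exact_mod_cast h4.trans h3
    refine le_trans ?_ h5
    push_cast
    simp only [Matrix.mulVec, dotProduct, Pi.one_apply, mul_one]
    refine (norm_sum_le _ _).trans (le_of_eq (Finset.sum_congr rfl fun j _ => ?_))
    rw [hpow, Matrix.map_apply, Complex.norm_real]
  exact Summable.of_norm_bounded_eventually_nat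
    (summable_geometric_of_lt_one r.coe_nonneg hr2') hev

end Gelfand

/-- The witness is `u = ∑ₙ Bⁿ 1`, which satisfies `B u = u - 1`. -/
lemma exists_isSubinvariant {d : ℕ} {B : Matrix (Fin d) (Fin d) ℝ} (h0 : ∀ i j, 0 ≤ B i j)
    (hB : specRad B < 1) : ∃ u β, IsSubinvariant B u β := by
  have hs := summable_pow_mulVec_one hB
  set u : Fin d → ℝ := fun i => ∑' n : ℕ, ((B ^ n).mulVec 1) i with hu
  have hrec : ∀ i, ∑ j, B i j * u j = u i - 1 := by
    intro i
    have h1 : u i = ((B ^ 0).mulVec 1) i + ∑' n : ℕ, ((B ^ (n + 1)).mulVec 1) i :=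
      (hs i).tsum_eq_zero_add
    have h2 : ∀ n, ((B ^ (n + 1)).mulVec 1) i = ∑ j, B i j * ((B ^ n).mulVec 1) j := fun n => by
      rw [pow_succ', ← Matrix.mulVec_mulVec]
      rfl
    simp only [h2] at h1
    rw [Summable.tsum_finsetSum fun j _ => (hs j).mul_left _] at h1
    simp only [tsum_mul_left, pow_zero, Matrix.one_mulVec, Pi.one_apply] at h1
    linarith
  have hnn : ∀ n i, 0 ≤ ((B ^ n).mulVec 1) i := by
    intro n
    induction n with
    | zero => intro i; simp
    | succ n ih =>
      intro i
      rw [pow_succ', ← Matrix.mulVec_mulVec]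
      change 0 ≤ ∑ j, B i j * ((B ^ n).mulVec 1) j
      exact Finset.sum_nonneg fun j _ => mul_nonneg (h0 i j) (ih j)
  have hu0 : ∀ i, 0 ≤ u i := fun i => tsum_nonneg fun n => hnn n i
  have hu1 : ∀ i, 1 ≤ u i := fun i => by
    have := hrec i
    have := Finset.sum_nonneg fun j (_ : j ∈ Finset.univ) => mul_nonneg (h0 i j) (hu0 j)
    linarith
  have hU : ∀ i, u i ≤ 1 + ∑ j, u j := fun i => by
    have := Finset.single_le_sum (fun j _ => hu0 j) (Finset.mem_univ i)
    linarith
  have hUpos : 1 ≤ 1 + ∑ j, u j := by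
    have := Finset.sum_nonneg fun j (_ : j ∈ Finset.univ) => hu0 j
    linarith
  refine ⟨u, 1 - 1 / (1 + ∑ j, u j), h0, hu1, ?_, ?_, fun i => ?_⟩
  · rw [sub_nonneg, div_le_one (by linarith)]
    exact hUpos
  · have : 0 < 1 / (1 + ∑ j, u j) := by positivity
    linarith
  · rw [hrec, sub_mul, one_mul, one_div, inv_mul_eq_div]
    have : u i / (1 + ∑ j, u j) ≤ 1 := by
      rw [div_le_one (by linarith)]
      exact hU i
    linarith

/-! ### The Poisson equation of a finite driven chain -/

section FinitePoisson

variable {d : ℕ} {P : Matrix (Fin d) (Fin d) ℝ} {σ : Type*} {τ : Fin d → Fin d → σ → σ}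

lemma transOp_le_of_le (hP : P ∈ Matrix.rowStochastic ℝ (Fin d)) {h : Fin d → σ → ℝ} {c : ℝ}
    (hc : ∀ i s, h i s ≤ c) (i : Fin d) (s : σ) : transOp P τ h i s ≤ c :=
  calc transOp P τ h i s ≤ ∑ j, P i j * c := Finset.sum_le_sum fun j _ =>
        mul_le_mul_of_nonneg_left (hc _ _) (Matrix.nonneg_of_mem_rowStochastic hP)
    _ = c := by rw [← Finset.sum_mul, Matrix.sum_row_of_mem_rowStochastic hP, one_mul]

lemma transOp_neg (h : Fin d → σ → ℝ) (i : Fin d) (s : σ) :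
    transOp P τ (fun i s => -h i s) i s = -transOp P τ h i s := by
  simp [transOp]

/-- Where a harmonic function attains its maximum, it attains it at all possible successors. -/
lemma eq_max_of_step (hP : P ∈ Matrix.rowStochastic ℝ (Fin d)) {h : Fin d → σ → ℝ} {c : ℝ}
    (hharm : ∀ i s, transOp P τ h i s = h i s) (hc : ∀ i s, h i s ≤ c) {i j : Fin d} {s : σ}
    (hij : 0 < P i j) (his : h i s = c) : h j (τ i j s) = c := by
  have h1 : ∑ k, P i k * (c - h k (τ i k s)) = 0 := by
    simp only [mul_sub, Finset.sum_sub_distrib]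
    rw [← Finset.sum_mul, Matrix.sum_row_of_mem_rowStochastic hP]
    have := hharm i s
    rw [transOp, his] at this
    linarith
  have h2 := (Finset.sum_eq_zero_iff_of_nonneg fun k _ =>
    mul_nonneg (Matrix.nonneg_of_mem_rowStochastic hP) (sub_nonneg.2 (hc k (τ i k s)))).1 h1 j
      (Finset.mem_univ j)
  rcases mul_eq_zero.1 h2 with h3 | h3
  · exact absurd h3 hij.ne'
  · linarith

/-- If all harmonic functions are constant, then every function on a finite state space is a
constant plus a coboundary. -/
lemma exists_poisson_of_harmonic_const (hP : P ∈ Matrix.rowStochastic ℝ (Fin d)) [Finite σ]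
    [Nonempty (Fin d × σ)]
    (hconst : ∀ h : Fin d → σ → ℝ, (∀ i s, transOp P τ h i s = h i s) →
      ∀ i s i' s', h i s = h i' s') (f : Fin d → σ → ℝ) :
    ∃ (c : ℝ) (g : Fin d → σ → ℝ), ∀ i s, f i s = c + g i s - transOp P τ g i s := by
  have := Fintype.ofFinite σ
  obtain ⟨i₀, s₀⟩ := Classical.arbitrary (Fin d × σ)
  have hbound : ∀ (h : Fin d → σ → ℝ) (κ : ℝ),
      (∀ i s, h i s - transOp P τ h i s = κ) → 0 ≤ κ := by
    intro h κ hκ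
    obtain ⟨z, -, hz⟩ := Finset.exists_max_image Finset.univ (fun z : Fin d × σ => h z.1 z.2)
      ⟨(i₀, s₀), Finset.mem_univ _⟩
    have := transOp_le_of_le (τ := τ) hP (fun i s => hz (i, s) (Finset.mem_univ _)) z.1 z.2
    have := hκ z.1 z.2
    linarith
  let L : (Fin d → σ → ℝ) →ₗ[ℝ] (Fin d → σ → ℝ) :=
    { toFun := fun g i s => g i s - transOp P τ g i s + g i₀ s₀
      map_add' := fun g g' => by
        funext i s
        simp only [transOp, Pi.add_apply, mul_add, Finset.sum_add_distrib]
        ring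
      map_smul' := fun c g => by
        funext i s
        simp only [transOp, Pi.smul_apply, smul_eq_mul, RingHom.id_apply, mul_add, mul_sub,
          Finset.mul_sum]
        congr 2
        exact Finset.sum_congr rfl fun j _ => by ring }
  have hinj : Function.Injective L := by
    rw [injective_iff_map_eq_zero]
    intro g hg
    have hg' : ∀ i s, g i s - transOp P τ g i s = -g i₀ s₀ := fun i s => by
      have : g i s - transOp P τ g i s + g i₀ s₀ = 0 := congrFun (congrFun hg i) s
      linarith
    have h1 := hbound g _ hg'
    have h2 := hbound (fun i s => -g i s) (g i₀ s₀) fun i s => by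
      rw [transOp_neg]
      linarith [hg' i s]
    have h3 : g i₀ s₀ = 0 := by linarith
    funext i s
    rw [hconst g (fun i s => by linarith [hg' i s]) i s i₀ s₀, h3]
    rfl
  obtain ⟨g, hg⟩ := LinearMap.injective_iff_surjective.1 hinj f
  refine ⟨g i₀ s₀, g, fun i s => ?_⟩
  have : g i s - transOp P τ g i s + g i₀ s₀ = f i s := congrFun (congrFun hg i) s
  linarith

/-- Suppose that the driven state is a matrix of bits whose entries evolve separately, and that
arriving at `j` resets column `j`. Two copies of the chain moved along a common path through all
positions coalesce; hence harmonic functions are constant. -/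
lemma harmonic_const_of_reset {α : Type*} [Finite α]
    {τ : Fin d → Fin d → (Fin d → Fin d → α) → (Fin d → Fin d → α)}
    (hP : P ∈ Matrix.rowStochastic ℝ (Fin d)) (hirr : P.IsIrreducible)
    (hτ : ∀ i j s s' k l, (s k l = s' k l ∨ l = j) → τ i j s k l = τ i j s' k l)
    {h : Fin d → (Fin d → Fin d → α) → ℝ} (hharm : ∀ i s, transOp P τ h i s = h i s) :
    ∀ i s i' s', h i s = h i' s' := by
  intro i₀ s₀ i₁ s₁
  have := Fintype.ofFinite α
  classical
  obtain ⟨z, -, hz⟩ := Finset.exists_max_image Finset.univ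
    (fun z : Fin d × (Fin d → Fin d → α) => h z.1 z.2) ⟨(i₀, s₀), Finset.mem_univ _⟩
  obtain ⟨y, -, hy⟩ := Finset.exists_min_image Finset.univ
    (fun z : Fin d × (Fin d → Fin d → α) => h z.1 z.2) ⟨(i₀, s₀), Finset.mem_univ _⟩
  have hmax : ∀ i s, h i s ≤ h z.1 z.2 := fun i s => hz (i, s) (Finset.mem_univ _)
  have hmin : ∀ i s, h y.1 y.2 ≤ h i s := fun i s => hy (i, s) (Finset.mem_univ _)
  let _ := P.toQuiver
  -- transport of maximizers and minimizers along a path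
  have hpath : ∀ {i c : Fin d} (p : Quiver.Path i c),
      ∃ φ : (Fin d → Fin d → α) → (Fin d → Fin d → α),
        (∀ s, h i s = h z.1 z.2 → h c (φ s) = h z.1 z.2) ∧
        (∀ s, h i s = h y.1 y.2 → h c (φ s) = h y.1 y.2) ∧
        ∀ s s' k l, (s k l = s' k l ∨ (0 < p.length ∧ l = c)) → φ s k l = φ s' k l := by
    intro i c p
    induction p with
    | nil => exact ⟨id, fun s hs => hs, fun s hs => hs, fun s s' k l hs => by simpa using hs⟩
    | @cons b c p e ih =>
      obtain ⟨φ, h1, h2, h3⟩ := ih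
      have hbc : 0 < P b c := e.down
      refine ⟨fun s => τ b c (φ s), fun s hs => ?_, fun s hs => ?_, fun s s' k l hs => ?_⟩
      · exact eq_max_of_step hP hharm hmax hbc (h1 s hs)
      · have := eq_max_of_step (τ := τ) (h := fun i s => -h i s) (c := -h y.1 y.2) hP
          (fun i s => by rw [transOp_neg, hharm]) (fun i s => neg_le_neg (hmin i s)) hbc
          (congrArg Neg.neg (h2 s hs))
        exact neg_injective this
      · refine hτ _ _ _ _ _ _ ?_
        rcases hs with hs | hs
        · exact Or.inl (h3 s s' k l (Or.inl hs))
        · exact Or.inr hs.2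
  -- a maximizer and a minimizer with the same position and the same columns in `T`
  have hpair : ∀ T : Finset (Fin d), ∃ i s s', h i s = h z.1 z.2 ∧ h i s' = h y.1 y.2 ∧
      ∀ k, ∀ l ∈ T, s k l = s' k l := by
    intro T
    induction T using Finset.induction_on with
    | empty =>
      obtain ⟨p, -⟩ := hirr.connected y.1 z.1
      obtain ⟨φ, -, h2, -⟩ := hpath p
      exact ⟨z.1, z.2, φ y.2, rfl, h2 _ rfl, by simp⟩
    | insert c T _ ih =>
      obtain ⟨i, s, s', h1, h2, h3⟩ := ih
      obtain ⟨p, hp⟩ := hirr.connected i c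
      obtain ⟨φ, g1, g2, g3⟩ := hpath p
      refine ⟨c, φ s, φ s', g1 s h1, g2 s' h2, fun k l hl => g3 s s' k l ?_⟩
      rcases Finset.mem_insert.1 hl with hl | hl
      · exact Or.inr ⟨hp, hl⟩
      · exact Or.inl (h3 k l hl)
  obtain ⟨i, s, s', h1, h2, h3⟩ := hpair Finset.univ
  have hss : s = s' := by
    funext k l
    exact h3 k l (Finset.mem_univ l)
  have heq : h z.1 z.2 = h y.1 y.2 := by rw [← h1, ← h2, hss]
  linarith [hmax i₀ s₀, hmin i₀ s₀, hmax i₁ s₁, hmin i₁ s₁]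

end FinitePoisson

/-! ### Moments of the running weights -/

section Weights

variable {d : ℕ}

/-- The running weights after a move from `i` to `j`, as a function of those before it. -/
noncomputable def nextWeights (A P : Matrix (Fin d) (Fin d) ℝ) (i j : Fin d)
    (L : Matrix (Fin d) (Fin d) ℝ) : Matrix (Fin d) (Fin d) ℝ :=
  fun k l => if l = j then 0 else scaledWeights A P i j L k l

/-- Which cycles are open, that is, have a nonzero running weight. -/
noncomputable def pattern (L : Matrix (Fin d) (Fin d) ℝ) : Fin d → Fin d → Bool :=
  fun k l => decide (L k l ≠ 0)

/-- The pattern of open cycles after a move from `i` to `j`. -/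
noncomputable def nextPattern (A P : Matrix (Fin d) (Fin d) ℝ) (i j : Fin d)
    (s : Fin d → Fin d → Bool) : Fin d → Fin d → Bool :=
  fun k l => (s k l || decide (k = i)) && (decide (A i j / P i j ≠ 0) && decide (l ≠ j))

/-- Indicator that the cycle `(k, l)` is started when the chain leaves `i` with open cycles `s`. -/
def restartInd (k l i : Fin d) (s : Fin d → Fin d → Bool) : ℝ :=
  if k = i ∧ s k l = false then 1 else 0

/-- The size `1 + ∑ |Λ k l|` of a matrix of running weights. -/
def size (L : Matrix (Fin d) (Fin d) ℝ) : ℝ := 1 + ∑ k, ∑ l, |L k l|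

/-- The matrix of the `p`-th moments of the weight ratios; for `p = 2` it is the second moment
matrix. -/
noncomputable def momentMatrix (A P : Matrix (Fin d) (Fin d) ℝ) (p : ℝ) :
    Matrix (Fin d) (Fin d) ℝ :=
  fun i j => P i j * |A i j / P i j| ^ p

/-- The Lyapunov function `1 + ∑ |Λ k l|ᵖ uᵢ`. -/
noncomputable def lyapunov (u : Fin d → ℝ) (p : ℝ) (i : Fin d)
    (L : Matrix (Fin d) (Fin d) ℝ) : ℝ :=
  1 + ∑ k, ∑ l, |L k l| ^ p * u i

variable {A P : Matrix (Fin d) (Fin d) ℝ}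

lemma restartRow_eq (i : Fin d) (L : Matrix (Fin d) (Fin d) ℝ) (k l : Fin d) :
    restartRow i L k l = L k l + restartInd k l i (pattern L) := by
  by_cases h : k = i <;> by_cases h2 : L k l = 0 <;>
    simp [restartRow, restartInd, pattern, h, h2] <;> subst h <;> simp_all

lemma scaledWeights_apply (i j k l : Fin d) (L : Matrix (Fin d) (Fin d) ℝ) :
    scaledWeights A P i j L k l =
      A i j / P i j * (L k l + restartInd k l i (pattern L)) := by
  rw [← restartRow_eq]
  rfl

lemma nextWeights_apply (i j k l : Fin d) (L : Matrix (Fin d) (Fin d) ℝ) :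
    nextWeights A P i j L k l =
      if l = j then 0 else A i j / P i j * (L k l + restartInd k l i (pattern L)) := by
  rw [← scaledWeights_apply]
  rfl

lemma restartRow_ne_zero_iff (i k l : Fin d) (L : Matrix (Fin d) (Fin d) ℝ) :
    L k l + restartInd k l i (pattern L) ≠ 0 ↔ L k l ≠ 0 ∨ k = i := by
  by_cases h : k = i
  · subst h
    by_cases h2 : L k l = 0 <;> simp [restartInd, pattern, h2]
  · simp [restartInd, h]

lemma pattern_nextWeights (i j : Fin d) (L : Matrix (Fin d) (Fin d) ℝ) :
    pattern (nextWeights A P i j L) = nextPattern A P i j (pattern L) := by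
  funext k l
  rw [Bool.eq_iff_iff]
  simp only [pattern, nextPattern, nextWeights_apply, Bool.and_eq_true, Bool.or_eq_true,
    decide_eq_true_eq]
  by_cases hl : l = j
  · simp [hl]
  · rw [if_neg hl, mul_ne_zero_iff]
    change _ ∧ (L k l + restartInd k l i (pattern L) ≠ 0) ↔ _
    rw [restartRow_ne_zero_iff]
    tauto

lemma restartInd_nonneg (k l i : Fin d) (s : Fin d → Fin d → Bool) : 0 ≤ restartInd k l i s := by
  unfold restartInd
  split_ifs <;> norm_num

lemma restartInd_le_one (k l i : Fin d) (s : Fin d → Fin d → Bool) : restartInd k l i s ≤ 1 := by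
  unfold restartInd
  split_ifs <;> norm_num

lemma abs_add_restartInd_le (k l i : Fin d) (L : Matrix (Fin d) (Fin d) ℝ) :
    |L k l + restartInd k l i (pattern L)| ≤ |L k l| + 1 :=
  (abs_add_le _ _).trans (add_le_add le_rfl
    (abs_le.2 ⟨by linarith [restartInd_nonneg k l i (pattern L)], restartInd_le_one _ _ _ _⟩))

lemma abs_nextWeights_le (i j k l : Fin d) (L : Matrix (Fin d) (Fin d) ℝ) :
    |nextWeights A P i j L k l| ≤
      |A i j / P i j| * |L k l + restartInd k l i (pattern L)| := by
  rw [nextWeights_apply]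
  split_ifs
  · simpa using by positivity
  · rw [abs_mul]

/-- A running weight that is restarted was zero, so no convexity constant is lost here. -/
lemma abs_add_restartInd_rpow_le {p : ℝ} (hp : 0 < p) (k l i : Fin d)
    (L : Matrix (Fin d) (Fin d) ℝ) :
    |L k l + restartInd k l i (pattern L)| ^ p ≤ |L k l| ^ p + 1 := by
  by_cases h : k = i ∧ L k l = 0
  · obtain ⟨rfl, h2⟩ := h
    have : restartInd k l k (pattern L) = 1 := by simp [restartInd, pattern, h2]
    rw [h2, this]
    simp [Real.zero_rpow hp.ne']
  · have : restartInd k l i (pattern L) = 0 := by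
      exact if_neg fun h' => h ⟨h'.1, by simpa [pattern] using h'.2⟩
    rw [this, add_zero]
    linarith

lemma one_le_size (L : Matrix (Fin d) (Fin d) ℝ) : 1 ≤ size L := by
  have : 0 ≤ ∑ k, ∑ l, |L k l| :=
    Finset.sum_nonneg fun k _ => Finset.sum_nonneg fun l _ => abs_nonneg _
  unfold size
  linarith

lemma abs_le_size (L : Matrix (Fin d) (Fin d) ℝ) (k l : Fin d) : |L k l| ≤ size L := by
  have h1 : |L k l| ≤ ∑ l, |L k l| :=
    Finset.single_le_sum (fun l _ => abs_nonneg (L k l)) (Finset.mem_univ l)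
  have h2 : ∑ l, |L k l| ≤ ∑ k, ∑ l, |L k l| :=
    Finset.single_le_sum (f := fun k => ∑ l, |L k l|)
      (fun k _ => Finset.sum_nonneg fun l _ => abs_nonneg _) (Finset.mem_univ k)
  unfold size
  linarith

lemma exists_abs_le {ι : Type*} [Finite ι] (f : ι → ℝ) : ∃ C, 0 ≤ C ∧ ∀ x, |f x| ≤ C := by
  have := Fintype.ofFinite ι
  exact ⟨∑ x, |f x|, Finset.sum_nonneg fun x _ => abs_nonneg _, fun x =>
    Finset.single_le_sum (fun x _ => abs_nonneg (f x)) (Finset.mem_univ x)⟩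

lemma exists_size_nextWeights_le (A P : Matrix (Fin d) (Fin d) ℝ) :
    ∃ C, 1 ≤ C ∧ ∀ i j L, size (nextWeights A P i j L) ≤ C * size L := by
  obtain ⟨R, hR0, hR⟩ := exists_abs_le fun x : Fin d × Fin d => A x.1 x.2 / P x.1 x.2
  have hd : (0 : ℝ) ≤ (d : ℝ) * d := by positivity
  refine ⟨1 + R * (1 + d * d), by nlinarith [mul_nonneg hR0 hd], fun i j L => ?_⟩
  have h1 : ∀ k l, |nextWeights A P i j L k l| ≤ R * (|L k l| + 1) := fun k l =>
    (abs_nextWeights_le i j k l L).trans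
      (mul_le_mul (hR (i, j)) (abs_add_restartInd_le k l i L) (abs_nonneg _) hR0)
  have h2 : ∑ k, ∑ l, |nextWeights A P i j L k l| ≤ R * (∑ k, ∑ l, |L k l| + d * d) := by
    refine (Finset.sum_le_sum fun k _ => Finset.sum_le_sum fun l _ => h1 k l).trans (le_of_eq ?_)
    simp [← Finset.mul_sum, Finset.sum_add_distrib]
  have h3 : ∑ k, ∑ l, |L k l| = size L - 1 := by simp [size]
  have h4 := one_le_size L
  rw [h3] at h2
  have h5 : size (nextWeights A P i j L) ≤ 1 + R * (size L - 1 + d * d) := by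
    unfold size at h2 ⊢
    linarith
  nlinarith [mul_nonneg hR0 hd]

lemma momentMatrix_nonneg (hP : ∀ i j, 0 ≤ P i j) (p : ℝ) (i j : Fin d) :
    0 ≤ momentMatrix A P p i j :=
  mul_nonneg (hP i j) (Real.rpow_nonneg (abs_nonneg _) _)

lemma momentMatrix_two : momentMatrix A P 2 = secondMomentMatrix A P := by
  funext i j
  by_cases h : P i j = 0
  · simp [momentMatrix, secondMomentMatrix, h]
  · simp only [momentMatrix, secondMomentMatrix, if_pos h, ne_eq, Real.rpow_two,
      sq_abs]
    field_simp

lemma one_le_lyapunov {u : Fin d → ℝ} (hu : ∀ i, 1 ≤ u i) (p : ℝ) (i : Fin d)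
    (L : Matrix (Fin d) (Fin d) ℝ) : 1 ≤ lyapunov u p i L := by
  have : 0 ≤ ∑ k, ∑ l, |L k l| ^ p * u i :=
    Finset.sum_nonneg fun k _ => Finset.sum_nonneg fun l _ =>
      mul_nonneg (Real.rpow_nonneg (abs_nonneg _) _) (by linarith [hu i])
  unfold lyapunov
  linarith

lemma exists_transOp_lyapunov_le (hP : P ∈ Matrix.rowStochastic ℝ (Fin d)) {u : Fin d → ℝ}
    {p β : ℝ} (hp : 0 < p) (h : IsSubinvariant (momentMatrix A P p) u β) :
    ∃ b, 0 ≤ b ∧ ∀ i L, transOp P (nextWeights A P) (lyapunov u p) i L ≤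
      β * lyapunov u p i L + b := by
  have hu0 : ∀ i, 0 ≤ u i := fun i => (h.pos i).le
  have hU : ∀ i, u i ≤ ∑ j, u j := fun i =>
    Finset.single_le_sum (fun j _ => hu0 j) (Finset.mem_univ i)
  have hU0 : 0 ≤ ∑ j, u j := Finset.sum_nonneg fun j _ => hu0 j
  refine ⟨1 + β * (d * d * ∑ j, u j), by have := h.rate_nonneg; positivity, fun i L => ?_⟩
  have h1 : ∀ k l, ∑ j, P i j * (|nextWeights A P i j L k l| ^ p * u j) ≤
      β * (|L k l| ^ p * u i + ∑ j, u j) := by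
    intro k l
    have h2 : ∀ j, P i j * (|nextWeights A P i j L k l| ^ p * u j) ≤
        (|L k l| ^ p + 1) * (momentMatrix A P p i j * u j) := by
      intro j
      have hx := Real.rpow_le_rpow (abs_nonneg _) (abs_nextWeights_le (A := A) (P := P) i j k l L)
        hp.le
      rw [Real.mul_rpow (abs_nonneg _) (abs_nonneg _)] at hx
      have hy := hx.trans (mul_le_mul_of_nonneg_left (abs_add_restartInd_rpow_le hp k l i L)
        (Real.rpow_nonneg (abs_nonneg _) p))
      have hPij : 0 ≤ P i j := Matrix.nonneg_of_mem_rowStochastic hP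
      calc _ ≤ P i j * (|A i j / P i j| ^ p * (|L k l| ^ p + 1) * u j) :=
            mul_le_mul_of_nonneg_left (mul_le_mul_of_nonneg_right hy (hu0 j)) hPij
        _ = _ := by unfold momentMatrix; ring
    refine (Finset.sum_le_sum fun j _ => h2 j).trans ?_
    rw [← Finset.mul_sum]
    have hl : 0 ≤ |L k l| ^ p := Real.rpow_nonneg (abs_nonneg _) _
    have h3 := mul_le_mul_of_nonneg_left (h.sum_le i) (by linarith : 0 ≤ |L k l| ^ p + 1)
    have h4 := mul_le_mul_of_nonneg_left (hU i) h.rate_nonneg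
    linarith
  have h2 : transOp P (nextWeights A P) (lyapunov u p) i L =
      1 + ∑ k, ∑ l, ∑ j, P i j * (|nextWeights A P i j L k l| ^ p * u j) := by
    simp only [transOp, lyapunov, mul_add, mul_one, Finset.sum_add_distrib, Finset.mul_sum]
    rw [Matrix.sum_row_of_mem_rowStochastic hP, Finset.sum_comm]
    congr 1
    exact Finset.sum_congr rfl fun k _ => Finset.sum_comm
  rw [h2]
  have h3 : ∑ k, ∑ l, ∑ j, P i j * (|nextWeights A P i j L k l| ^ p * u j) ≤
      β * (∑ k, ∑ l, |L k l| ^ p * u i + d * d * ∑ j, u j) := by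
    refine (Finset.sum_le_sum fun k _ => Finset.sum_le_sum fun l _ => h1 k l).trans (le_of_eq ?_)
    simp only [← Finset.mul_sum, Finset.sum_add_distrib, Finset.sum_const, Finset.card_univ,
      Fintype.card_fin, nsmul_eq_mul]
    ring
  unfold lyapunov
  linarith [h.rate_nonneg]

lemma exists_size_rpow_le {u : Fin d → ℝ} (hu : ∀ i, 1 ≤ u i) {p : ℝ} (hp : 1 ≤ p) :
    ∃ C, 0 ≤ C ∧ ∀ i L, size L ^ p ≤ C * lyapunov u p i L := by
  refine ⟨(Fintype.card (Option (Fin d × Fin d)) : ℝ) ^ (p - 1), by positivity, fun i L => ?_⟩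
  have h := Real.rpow_sum_le_const_mul_sum_rpow_of_nonneg
    (f := fun o : Option (Fin d × Fin d) => o.elim 1 fun x => |L x.1 x.2|) Finset.univ hp
    (by rintro (_ | x) _ <;> simp)
  simp only [Fintype.sum_option, Option.elim, Fintype.sum_prod_type, Real.one_rpow,
    Finset.card_univ] at h
  refine h.trans (mul_le_mul_of_nonneg_left ?_ (by positivity))
  unfold lyapunov
  refine add_le_add le_rfl (Finset.sum_le_sum fun k _ => Finset.sum_le_sum fun l _ => ?_)
  exact le_mul_of_one_le_right (Real.rpow_nonneg (abs_nonneg _) _) (hu i)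

/-- A subinvariant vector for the second moments also serves for moments of an order slightly
above `2`, because the defining strict inequality is open in the exponent. -/
lemma IsSubinvariant.exists_higher_moment (hP : ∀ i j, 0 ≤ P i j) {u : Fin d → ℝ} {β : ℝ}
    (h : IsSubinvariant (momentMatrix A P 2) u β) :
    ∃ δ, 0 < δ ∧ δ ≤ 1 ∧ ∃ β', IsSubinvariant (momentMatrix A P (2 + δ)) u β' := by
  have hβ : β < (1 + β) / 2 := by linarith [h.rate_lt_one]
  have hev : ∀ᶠ δ in 𝓝 (0 : ℝ), ∀ i, ∑ j, momentMatrix A P (2 + δ) i j * u j <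
      (1 + β) / 2 * u i := by
    rw [eventually_all]
    intro i
    have hc : ContinuousAt (fun δ : ℝ => ∑ j, momentMatrix A P (2 + δ) i j * u j) 0 := by
      refine tendsto_finsetSum _ fun j _ => ?_
      have h1 : ContinuousAt (fun δ : ℝ => |A i j / P i j| ^ (2 + δ)) 0 :=
        (Real.continuousAt_const_rpow' (by norm_num)).comp (by fun_prop)
      exact (h1.const_mul (P i j)).mul_const (u j)
    refine hc.eventually_lt_const ?_
    simp only [add_zero]
    exact (h.sum_le i).trans_lt (mul_lt_mul_of_pos_right hβ (h.pos i))
  have hev' := (hev.filter_mono nhdsWithin_le_nhds).and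
    (Ioc_mem_nhdsGT (zero_lt_one : (0 : ℝ) < 1))
  obtain ⟨δ, h1, h2⟩ := (hev' : ∀ᶠ δ in 𝓝[>] (0 : ℝ), _).exists
  refine ⟨δ, h2.1, h2.2, (1 + β) / 2, fun i j => momentMatrix_nonneg hP _ i j, h.one_le, ?_, ?_,
    fun i => (h1 i).le⟩
  · linarith [h.rate_nonneg]
  · linarith [h.rate_lt_one]

/-- By the Cauchy-Schwarz inequality, the square root of a subinvariant vector for the second
moments is subinvariant for `|A|`. -/
lemma IsSubinvariant.abs_sqrt (hP : P ∈ Matrix.rowStochastic ℝ (Fin d))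
    (hAP : ∀ i j, P i j = 0 → A i j = 0) {u : Fin d → ℝ} {β : ℝ}
    (h : IsSubinvariant (momentMatrix A P 2) u β) :
    IsSubinvariant (fun i j => |A i j|) (fun i => √(u i)) (√β) where
  nonneg i j := abs_nonneg _
  one_le i := Real.one_le_sqrt.2 (h.one_le i)
  rate_nonneg := Real.sqrt_nonneg _
  rate_lt_one := by
    rw [Real.sqrt_lt' one_pos]
    linarith [h.rate_lt_one]
  sum_le i := by
    have hP0 : ∀ j, 0 ≤ P i j := fun j => Matrix.nonneg_of_mem_rowStochastic hP
    have hm0 : ∀ j, 0 ≤ momentMatrix A P 2 i j * u j := fun j =>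
      mul_nonneg (h.nonneg i j) (h.pos j).le
    have e : ∀ j, |A i j| * √(u j) = √(P i j) * √(momentMatrix A P 2 i j * u j) := by
      intro j
      rw [← Real.sqrt_mul (hP0 j), momentMatrix, Real.rpow_two, sq_abs]
      by_cases hz : P i j = 0
      · simp [hz, hAP i j hz]
      · rw [← Real.sqrt_sq (abs_nonneg (A i j)), ← Real.sqrt_mul (sq_nonneg _), sq_abs]
        congr 1
        field_simp
    simp only [e]
    have hcs := Real.sum_sqrt_mul_sqrt_le Finset.univ hP0 hm0
    rw [Matrix.sum_row_of_mem_rowStochastic hP, Real.sqrt_one, one_mul] at hcs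
    refine hcs.trans ?_
    rw [← Real.sqrt_mul h.rate_nonneg]
    exact Real.sqrt_le_sqrt (h.sum_le i)

/-- The running weights have bounded moments of some order larger than `2`. -/
lemma IsMarkovChain.exists_integral_size_rpow_le {Ω : Type*} [MeasurableSpace Ω] {μ : Measure Ω}
    [IsProbabilityMeasure μ] {X : ℕ → Ω → Fin d} (hX : IsMarkovChain μ P X)
    (hP : P ∈ Matrix.rowStochastic ℝ (Fin d)) {u : Fin d → ℝ} {β : ℝ}
    (h : IsSubinvariant (momentMatrix A P 2) u β) :
    ∃ δ : ℝ, 0 < δ ∧ δ ≤ 1 ∧ ∃ B, ∀ n,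
      ∫ ω, size (pathState (nextWeights A P) 0 (fun k => X k ω) n) ^ (2 + δ) ∂μ ≤ B := by
  obtain ⟨δ, hδ0, hδ1, β', h'⟩ :=
    h.exists_higher_moment fun i j => Matrix.nonneg_of_mem_rowStochastic hP
  obtain ⟨b, hb0, hb⟩ := exists_transOp_lyapunov_le hP (by linarith : 0 < 2 + δ) h'
  obtain ⟨C, hC0, hC⟩ := exists_size_rpow_le h.one_le (by linarith : 1 ≤ 2 + δ)
  have hβ' : 0 < 1 - β' := by linarith [h'.rate_lt_one]
  have h0 : ∀ i, lyapunov u (2 + δ) i 0 = 1 := fun i => by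
    have : (2 + δ) ≠ 0 := by linarith
    simp [lyapunov, Real.zero_rpow this]
  have hbd := hX.integral_le_of_drift (τ := nextWeights A P) (s₀ := 0) (B := 1 + b / (1 - β'))
    h'.rate_nonneg hb
    (fun i => by rw [h0]; have := div_nonneg hb0 hβ'.le; linarith)
    (by rw [mul_add, mul_div_cancel₀ _ hβ'.ne']; linarith)
  refine ⟨δ, hδ0, hδ1, C * (1 + b / (1 - β')), fun n => ?_⟩
  have hint := fun n (F : Fin d → Matrix (Fin d) (Fin d) ℝ → ℝ) =>
    hX.integrable_state (τ := nextWeights A P) (s₀ := 0) (fun _ _ _ => 0) n fun i s _ => F i s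
  calc _ ≤ ∫ ω, C * lyapunov u (2 + δ) (X n ω)
          (pathState (nextWeights A P) 0 (fun k => X k ω) n) ∂μ :=
        integral_mono (hint n fun _ s => size s ^ (2 + δ))
          (hint n fun i s => C * lyapunov u (2 + δ) i s) fun ω => hC _ _
    _ ≤ _ := by
        rw [integral_const_mul]
        exact mul_le_mul_of_nonneg_left (hbd n) hC0

end Weights

/-! ### The Poisson equation for polynomials in the running weights -/

section Poisson

variable {d : ℕ} {A P : Matrix (Fin d) (Fin d) ℝ}

/-- `G` is a solution of at most quadratic growth of the Poisson equation
`F = c + G - E[G(next state)]` for the chain of positions and running weights. -/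
def IsCorrector (A P : Matrix (Fin d) (Fin d) ℝ) (F : Fin d → Matrix (Fin d) (Fin d) ℝ → ℝ)
    (c : ℝ) (G : Fin d → Matrix (Fin d) (Fin d) ℝ → ℝ) : Prop :=
  (∃ C, 0 ≤ C ∧ ∀ i L, |G i L| ≤ C * size L ^ 2) ∧
    ∀ i L, F i L = c + G i L - transOp P (nextWeights A P) G i L

lemma IsCorrector.add {F F' : Fin d → Matrix (Fin d) (Fin d) ℝ → ℝ} {c c' : ℝ}
    {G G' : Fin d → Matrix (Fin d) (Fin d) ℝ → ℝ} (h : IsCorrector A P F c G)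
    (h' : IsCorrector A P F' c' G') :
    IsCorrector A P (fun i L => F i L + F' i L) (c + c') (fun i L => G i L + G' i L) := by
  obtain ⟨⟨C, hC0, hC⟩, hF⟩ := h
  obtain ⟨⟨C', hC0', hC'⟩, hF'⟩ := h'
  refine ⟨⟨C + C', add_nonneg hC0 hC0', fun i L => ?_⟩, fun i L => ?_⟩
  · rw [add_mul]
    exact (abs_add_le _ _).trans (add_le_add (hC i L) (hC' i L))
  · beta_reduce
    rw [hF, hF']
    simp only [transOp, mul_add, Finset.sum_add_distrib]
    ring

lemma IsCorrector.const_mul {F : Fin d → Matrix (Fin d) (Fin d) ℝ → ℝ} {c : ℝ}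
    {G : Fin d → Matrix (Fin d) (Fin d) ℝ → ℝ} (h : IsCorrector A P F c G) (t : ℝ) :
    IsCorrector A P (fun i L => t * F i L) (t * c) (fun i L => t * G i L) := by
  obtain ⟨⟨C, hC0, hC⟩, hF⟩ := h
  refine ⟨⟨|t| * C, by positivity, fun i L => ?_⟩, fun i L => ?_⟩
  · rw [abs_mul, mul_assoc]
    exact mul_le_mul_of_nonneg_left (hC i L) (abs_nonneg _)
  · beta_reduce
    rw [hF]
    simp only [transOp, mul_left_comm _ t, ← Finset.mul_sum]
    ring

lemma IsCorrector.congr {F F' : Fin d → Matrix (Fin d) (Fin d) ℝ → ℝ} {c : ℝ}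
    {G : Fin d → Matrix (Fin d) (Fin d) ℝ → ℝ} (h : IsCorrector A P F c G)
    (hF : ∀ i L, F' i L = F i L) : IsCorrector A P F' c G :=
  ⟨h.1, fun i L => (hF i L).trans (h.2 i L)⟩

lemma IsCorrector.zero : IsCorrector A P (fun _ _ => 0) 0 (fun _ _ => 0) :=
  ⟨⟨0, le_rfl, fun i L => by simp⟩, fun i L => by simp [transOp]⟩

lemma IsCorrector.sum {ι : Type*} (T : Finset ι)
    {F : ι → Fin d → Matrix (Fin d) (Fin d) ℝ → ℝ} {c : ι → ℝ}
    {G : ι → Fin d → Matrix (Fin d) (Fin d) ℝ → ℝ}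
    (h : ∀ x, IsCorrector A P (F x) (c x) (G x)) :
    IsCorrector A P (fun i L => ∑ x ∈ T, F x i L) (∑ x ∈ T, c x)
      (fun i L => ∑ x ∈ T, G x i L) := by
  classical
  induction T using Finset.induction_on with
  | empty => simpa using IsCorrector.zero
  | insert x T hx ih =>
    simp only [Finset.sum_insert hx]
    exact (h x).add ih

lemma one_le_size_sq (L : Matrix (Fin d) (Fin d) ℝ) : 1 ≤ size L ^ 2 :=
  one_le_pow₀ (one_le_size L)

/-- The Poisson equation of the finite chain of positions and patterns of open cycles. -/
lemma exists_poisson_pattern (hP : P ∈ Matrix.rowStochastic ℝ (Fin d)) (hirr : P.IsIrreducible)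
    (f : Fin d → (Fin d → Fin d → Bool) → ℝ) :
    ∃ (c : ℝ) (g : Fin d → (Fin d → Fin d → Bool) → ℝ), ∀ i s,
      f i s = c + g i s - transOp P (nextPattern A P) g i s := by
  rcases isEmpty_or_nonempty (Fin d) with hd | hd
  · exact ⟨0, 0, fun i => hd.elim i⟩
  · refine exists_poisson_of_harmonic_const hP (fun h hharm => ?_) f
    refine harmonic_const_of_reset hP hirr (fun i j s s' k l hs => ?_) hharm
    rcases hs with hs | hs
    · simp [nextPattern, hs]
    · simp [nextPattern, hs]

lemma exists_isCorrector_pattern (hP : P ∈ Matrix.rowStochastic ℝ (Fin d))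
    (hirr : P.IsIrreducible) (f : Fin d → (Fin d → Fin d → Bool) → ℝ) :
    ∃ c G, IsCorrector A P (fun i L => f i (pattern L)) c G := by
  obtain ⟨c, g, hg⟩ := exists_poisson_pattern (A := A) hP hirr f
  obtain ⟨C, hC0, hC⟩ := exists_abs_le fun x : Fin d × (Fin d → Fin d → Bool) => g x.1 x.2
  refine ⟨c, fun i L => g i (pattern L), ⟨C, hC0, fun i L => ?_⟩, fun i L => ?_⟩
  · exact (hC (i, pattern L)).trans (le_mul_of_one_le_right hC0 (one_le_size_sq L))
  · beta_reduce
    rw [hg]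
    simp only [transOp, pattern_nextWeights]

lemma mul_div_eq_of_imp (hAP : ∀ i j, P i j = 0 → A i j = 0) (i j : Fin d) :
    P i j * (A i j / P i j) = A i j := by
  by_cases h : P i j = 0
  · simp [h, hAP i j h]
  · field_simp

/-- The Poisson equation for functions linear in one running weight: after the leading
coefficient has been removed with `I - A`, only a function of the pattern remains. -/
lemma exists_isCorrector_linear (hP : P ∈ Matrix.rowStochastic ℝ (Fin d))
    (hirr : P.IsIrreducible) (hAP : ∀ i j, P i j = 0 → A i j = 0) {u : Fin d → ℝ} {β : ℝ}
    (hA : IsSubinvariant (fun i j => |A i j|) u β) (k l : Fin d)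
    (f : Fin d → (Fin d → Fin d → Bool) → ℝ) :
    ∃ c G, IsCorrector A P (fun i L => L k l * f i (pattern L)) c G := by
  obtain ⟨g, hg⟩ := hA.exists_sub_sum_eq (nextPattern A P)
    (b := fun i j => if l = j then 0 else A i j)
    (fun i j => by split_ifs <;> simp) f
  obtain ⟨C, hC0, hC⟩ := exists_abs_le fun x : Fin d × (Fin d → Fin d → Bool) => g x.1 x.2
  obtain ⟨c', G', hG'⟩ := exists_isCorrector_pattern (A := A) hP hirr fun i s =>
    restartInd k l i s * ∑ j, (if l = j then 0 else A i j) * g j (nextPattern A P i j s)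
  have h1 : IsCorrector A P (fun i L => L k l * f i (pattern L) - restartInd k l i (pattern L) *
      ∑ j, (if l = j then 0 else A i j) * g j (nextPattern A P i j (pattern L))) 0
      (fun i L => L k l * g i (pattern L)) := by
    refine ⟨⟨C, hC0, fun i L => ?_⟩, fun i L => ?_⟩
    · rw [abs_mul, mul_comm]
      refine mul_le_mul (hC (i, pattern L)) ((abs_le_size L k l).trans ?_) (abs_nonneg _) hC0
      exact le_self_pow₀ (one_le_size L) two_ne_zero
    · have e : transOp P (nextWeights A P) (fun i L => L k l * g i (pattern L)) i L =
          (L k l + restartInd k l i (pattern L)) *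
            ∑ j, (if l = j then 0 else A i j) * g j (nextPattern A P i j (pattern L)) := by
        rw [transOp, Finset.mul_sum]
        refine Finset.sum_congr rfl fun j _ => ?_
        rw [pattern_nextWeights, nextWeights_apply]
        split_ifs with hlj
        · simp
        · have h := mul_div_eq_of_imp hAP i j
          linear_combination (L k l + restartInd k l i (pattern L)) *
            g j (nextPattern A P i j (pattern L)) * h
      beta_reduce
      rw [e, ← hg i (pattern L)]
      ring
  have h2 := h1.add hG'
  simp only [sub_add_cancel] at h2
  exact ⟨_, _, h2⟩

/-- The Poisson equation for functions bilinear in the running weights: after the leading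
coefficient has been removed with the second moment matrix, linear terms remain. -/
lemma exists_isCorrector_bilinear (hP : P ∈ Matrix.rowStochastic ℝ (Fin d))
    (hirr : P.IsIrreducible) (hAP : ∀ i j, P i j = 0 → A i j = 0) {u : Fin d → ℝ} {β : ℝ}
    (hH : IsSubinvariant (momentMatrix A P 2) u β) (k l k' l' : Fin d)
    (f : Fin d → (Fin d → Fin d → Bool) → ℝ) :
    ∃ c G, IsCorrector A P (fun i L => L k l * L k' l' * f i (pattern L)) c G := by
  have hA := hH.abs_sqrt hP hAP
  obtain ⟨g, hg⟩ := hH.exists_sub_sum_eq (nextPattern A P)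
    (b := fun i j => if l = j ∨ l' = j then 0 else momentMatrix A P 2 i j)
    (fun i j => by
      have := hH.nonneg i j
      split_ifs
      · simpa using this
      · rw [abs_of_nonneg this]) f
  obtain ⟨C, hC0, hC⟩ := exists_abs_le fun x : Fin d × (Fin d → Fin d → Bool) => g x.1 x.2
  let t : Fin d → (Fin d → Fin d → Bool) → ℝ := fun i s =>
    ∑ j, (if l = j ∨ l' = j then 0 else momentMatrix A P 2 i j) * g j (nextPattern A P i j s)
  obtain ⟨c₁, G₁, h₁⟩ := exists_isCorrector_linear hP hirr hAP hA k l fun i s =>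
    restartInd k' l' i s * t i s
  obtain ⟨c₂, G₂, h₂⟩ := exists_isCorrector_linear hP hirr hAP hA k' l' fun i s =>
    restartInd k l i s * t i s
  obtain ⟨c₃, G₃, h₃⟩ := exists_isCorrector_pattern (A := A) hP hirr fun i s =>
    restartInd k l i s * restartInd k' l' i s * t i s
  have h0 : IsCorrector A P (fun i L => L k l * L k' l' * f i (pattern L) -
      (L k l * (restartInd k' l' i (pattern L) * t i (pattern L)) +
        L k' l' * (restartInd k l i (pattern L) * t i (pattern L)) +
        restartInd k l i (pattern L) * restartInd k' l' i (pattern L) * t i (pattern L))) 0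
      (fun i L => L k l * L k' l' * g i (pattern L)) := by
    refine ⟨⟨C, hC0, fun i L => ?_⟩, fun i L => ?_⟩
    · rw [abs_mul, mul_comm, abs_mul]
      refine mul_le_mul (hC (i, pattern L)) ?_ (by positivity) hC0
      rw [sq]
      exact mul_le_mul (abs_le_size L k l) (abs_le_size L k' l') (abs_nonneg _)
        (zero_le_one.trans (one_le_size L))
    · have e : transOp P (nextWeights A P) (fun i L => L k l * L k' l' * g i (pattern L)) i L =
          (L k l + restartInd k l i (pattern L)) * (L k' l' + restartInd k' l' i (pattern L)) *
            t i (pattern L) := by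
        rw [transOp, Finset.mul_sum]
        refine Finset.sum_congr rfl fun j _ => ?_
        rw [pattern_nextWeights, nextWeights_apply, nextWeights_apply]
        by_cases hl : l = j
        · simp [hl]
        by_cases hl' : l' = j
        · simp [hl']
        rw [if_neg hl, if_neg hl', if_neg (by tauto), momentMatrix, Real.rpow_two, sq_abs]
        ring
      have e2 : f i (pattern L) = g i (pattern L) - t i (pattern L) := (hg i (pattern L)).symm
      beta_reduce
      rw [e, e2]
      ring
  have h4 := h0.add ((h₁.add h₂).add h₃)
  simp only [sub_add_cancel] at h4
  exact ⟨_, _, h4⟩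

lemma exists_isCorrector_sum_mul (hP : P ∈ Matrix.rowStochastic ℝ (Fin d))
    (hirr : P.IsIrreducible) (hAP : ∀ i j, P i j = 0 → A i j = 0) {u : Fin d → ℝ} {β : ℝ}
    (hH : IsSubinvariant (momentMatrix A P 2) u β) (k l k' l' : Fin d)
    (e e' : Fin d → Fin d → ℝ) (f f' : Fin d → (Fin d → Fin d → Bool) → Fin d → ℝ) :
    ∃ c G, IsCorrector A P (fun i L => ∑ j, P i j *
      ((L k l * e i j + f i (pattern L) j) * (L k' l' * e' i j + f' i (pattern L) j))) c G := by
  have hA := hH.abs_sqrt hP hAP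
  obtain ⟨c₀, G₀, h₀⟩ := exists_isCorrector_bilinear hP hirr hAP hH k l k' l' fun i _ =>
    ∑ j, P i j * (e i j * e' i j)
  obtain ⟨c₁, G₁, h₁⟩ := exists_isCorrector_linear hP hirr hAP hA k l fun i s =>
    ∑ j, P i j * (e i j * f' i s j)
  obtain ⟨c₂, G₂, h₂⟩ := exists_isCorrector_linear hP hirr hAP hA k' l' fun i s =>
    ∑ j, P i j * (f i s j * e' i j)
  obtain ⟨c₃, G₃, h₃⟩ := exists_isCorrector_pattern (A := A) hP hirr fun i s =>
    ∑ j, P i j * (f i s j * f' i s j)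
  have h := ((h₀.add h₁).add h₂).add h₃
  refine ⟨_, _, h.congr fun i L => ?_⟩
  simp only [Finset.mul_sum, ← Finset.sum_add_distrib]
  exact Finset.sum_congr rfl fun j _ => by ring

/-! ### The asymptotic covariance matrix -/

/-- In the Poisson equation of a nonnegative function the constant is nonnegative, being the
limit of averages of that function along the iterates of the transition operator. -/
lemma nonneg_of_le_add_transOp {S : Type*} {τ : Fin d → Fin d → S → S}
    (hP : P ∈ Matrix.rowStochastic ℝ (Fin d)) {G V : Fin d → S → ℝ} {c β b : ℝ} (hβ0 : 0 ≤ β)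
    (hβ1 : β < 1) (hb : 0 ≤ b) (hG : ∀ i s, transOp P τ G i s ≤ c + G i s)
    (hGV : ∀ i s, -G i s ≤ V i s) (hV0 : ∀ i s, 0 ≤ V i s)
    (hV : ∀ i s, transOp P τ V i s ≤ β * V i s + b)
    (i : Fin d) (s : S) : 0 ≤ c := by
  have hmono : ∀ {F F' : Fin d → S → ℝ}, (∀ i s, F i s ≤ F' i s) →
      ∀ i s, transOp P τ F i s ≤ transOp P τ F' i s := fun h i s =>
    Finset.sum_le_sum fun j _ => mul_le_mul_of_nonneg_left (h _ _)
      (Matrix.nonneg_of_mem_rowStochastic hP)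
  have haff : ∀ (F : Fin d → S → ℝ) (t κ : ℝ) (i : Fin d) (s : S),
      transOp P τ (fun i s => t * F i s + κ) i s = t * transOp P τ F i s + κ := by
    intro F t κ i s
    simp only [transOp, mul_add, Finset.sum_add_distrib, Finset.mul_sum]
    rw [← Finset.sum_mul, Matrix.sum_row_of_mem_rowStochastic hP, one_mul]
    congr 1
    exact Finset.sum_congr rfl fun j _ => by ring
  have h1 : ∀ n : ℕ, ∀ i s, (transOp P τ)^[n] G i s ≤ 1 * G i s + n * c := by
    intro n
    induction n with
    | zero => intro i s; simp
    | succ n ih =>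
      intro i s
      rw [Function.iterate_succ_apply']
      refine (hmono ih i s).trans ?_
      rw [haff]
      push_cast
      linarith [hG i s]
  have hbβ : 0 ≤ b / (1 - β) := div_nonneg hb (by linarith)
  have h2 : ∀ n : ℕ, ∀ i s, -(β ^ n * V i s + b / (1 - β) * (1 - β ^ n)) ≤
      (transOp P τ)^[n] G i s := by
    intro n
    induction n with
    | zero =>
      intro i s
      simp only [pow_zero, Function.iterate_zero, id]
      linarith [hGV i s]
    | succ n ih =>
      intro i s
      rw [Function.iterate_succ_apply']
      refine le_trans ?_ (hmono ih i s)
      have e : (fun i s => -(β ^ n * V i s + b / (1 - β) * (1 - β ^ n))) =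
          fun i s => -β ^ n * V i s + -(b / (1 - β) * (1 - β ^ n)) := by
        funext i s
        ring
      rw [e, haff]
      have h3 := mul_le_mul_of_nonneg_left (hV i s) (pow_nonneg hβ0 n)
      have h4 : b / (1 - β) * (1 - β) = b := div_mul_cancel₀ _ (by linarith)
      have h5 : b / (1 - β) * (1 - β ^ (n + 1)) =
          b / (1 - β) * (1 - β ^ n) + β ^ n * (b / (1 - β) * (1 - β)) := by ring
      rw [h4] at h5
      rw [h5, pow_succ]
      linarith
  by_contra! hc
  obtain ⟨n, hn⟩ := exists_nat_gt ((G i s + V i s + b / (1 - β)) / -c)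
  rw [div_lt_iff₀ (by linarith)] at hn
  have h3 := h1 n i s
  have h4 := h2 n i s
  have h5 : β ^ n ≤ 1 := pow_le_one₀ hβ0 hβ1.le
  have h6 := mul_le_mul_of_nonneg_right h5 (hV0 i s)
  have h7 := mul_nonneg hbβ (pow_nonneg hβ0 n)
  linarith

lemma IsCorrector.const_nonneg (hP : P ∈ Matrix.rowStochastic ℝ (Fin d)) {u : Fin d → ℝ} {β : ℝ}
    (hH : IsSubinvariant (momentMatrix A P 2) u β)
    {F : Fin d → Matrix (Fin d) (Fin d) ℝ → ℝ} {c : ℝ}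
    {G : Fin d → Matrix (Fin d) (Fin d) ℝ → ℝ} (h : IsCorrector A P F c G)
    (hF : ∀ i L, 0 ≤ F i L) (i : Fin d) : 0 ≤ c := by
  obtain ⟨⟨C, hC0, hC⟩, hFG⟩ := h
  obtain ⟨b, hb0, hb⟩ := exists_transOp_lyapunov_le hP two_pos hH
  obtain ⟨C', hC0', hC'⟩ := exists_size_rpow_le (d := d) hH.one_le one_le_two
  have hCC : 0 ≤ C * C' := mul_nonneg hC0 hC0'
  refine nonneg_of_le_add_transOp (τ := nextWeights A P) hP (G := G)
    (V := fun i L => C * C' * lyapunov u 2 i L) (b := C * C' * b) hH.rate_nonneg hH.rate_lt_one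
    (mul_nonneg hCC hb0) (fun i L => ?_) (fun i L => ?_) (fun i L => ?_) (fun i L => ?_) i 0
  · linarith [hFG i L, hF i L]
  · refine (neg_le_abs _).trans ((hC i L).trans ?_)
    have h2 := hC' i L
    rw [Real.rpow_two] at h2
    rw [mul_assoc]
    exact mul_le_mul_of_nonneg_left h2 hC0
  · exact mul_nonneg hCC (zero_le_one.trans (one_le_lyapunov hH.one_le 2 i L))
  · have e : transOp P (nextWeights A P) (fun i L => C * C' * lyapunov u 2 i L) i L =
        C * C' * transOp P (nextWeights A P) (lyapunov u 2) i L := by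
      simp only [transOp, Finset.mul_sum]
      exact Finset.sum_congr rfl fun j _ => by ring
    rw [e]
    have := mul_le_mul_of_nonneg_left (hb i L) hCC
    linarith

/-- The asymptotic covariance matrix of a family of increments, each affine in one running
weight. -/
lemma exists_covariance (hP : P ∈ Matrix.rowStochastic ℝ (Fin d))
    (hirr : P.IsIrreducible) (hAP : ∀ i j, P i j = 0 → A i j = 0) {u : Fin d → ℝ} {β : ℝ}
    (hH : IsSubinvariant (momentMatrix A P 2) u β)
    (e : Fin d × Fin d → Fin d → Fin d → ℝ)
    (f : Fin d × Fin d → Fin d → (Fin d → Fin d → Bool) → Fin d → ℝ) :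
    ∃ V : Matrix (Fin d × Fin d) (Fin d × Fin d) ℝ, V.PosSemidef ∧
      ∀ θ : Fin d × Fin d → ℝ, ∃ G, IsCorrector A P (fun i L => ∑ j, P i j *
        (∑ a, θ a * (L a.1 a.2 * e a i j + f a i (pattern L) j)) ^ 2) (θ ⬝ᵥ V.mulVec θ) G := by
  choose c G hG using fun a b : Fin d × Fin d =>
    exists_isCorrector_sum_mul hP hirr hAP hH a.1 a.2 b.1 b.2 (e a) (e b) (f a) (f b)
  -- the constants need not be known to be symmetric, hence the symmetrization
  have hquad : ∀ θ : Fin d × Fin d → ℝ,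
      θ ⬝ᵥ (Matrix.of fun a b => (c a b + c b a) / 2).mulVec θ =
        ∑ a, ∑ b, θ a * θ b * c a b := by
    intro θ
    have h1 : ∑ a, ∑ b, θ a * θ b * c b a = ∑ a, ∑ b, θ a * θ b * c a b := by
      rw [Finset.sum_comm]
      exact Finset.sum_congr rfl fun a _ => Finset.sum_congr rfl fun b _ => by ring
    have h2 : θ ⬝ᵥ (Matrix.of fun a b => (c a b + c b a) / 2).mulVec θ =
        (∑ a, ∑ b, θ a * θ b * c a b + ∑ a, ∑ b, θ a * θ b * c b a) / 2 := by
      simp only [dotProduct, Matrix.mulVec, Matrix.of_apply, Finset.mul_sum,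
        ← Finset.sum_add_distrib, Finset.sum_div]
      exact Finset.sum_congr rfl fun a _ => Finset.sum_congr rfl fun b _ => by ring
    rw [h2, h1]
    ring
  have hcorr : ∀ θ : Fin d × Fin d → ℝ, ∃ G, IsCorrector A P (fun i L => ∑ j, P i j *
        (∑ a, θ a * (L a.1 a.2 * e a i j + f a i (pattern L) j)) ^ 2)
        (θ ⬝ᵥ (Matrix.of fun a b => (c a b + c b a) / 2).mulVec θ) G := by
    intro θ
    have h := IsCorrector.sum Finset.univ fun a => IsCorrector.sum Finset.univ fun b =>
      (hG a b).const_mul (θ a * θ b)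
    rw [hquad]
    refine ⟨_, h.congr fun i L => ?_⟩
    simp only [sq, Finset.sum_mul_sum]
    simp only [Finset.mul_sum]
    rw [Finset.sum_comm]
    refine Finset.sum_congr rfl fun a _ => ?_
    rw [Finset.sum_comm]
    exact Finset.sum_congr rfl fun b _ => Finset.sum_congr rfl fun j _ => by ring
  refine ⟨Matrix.of fun a b => (c a b + c b a) / 2, ?_, hcorr⟩
  refine Matrix.PosSemidef.of_dotProduct_mulVec_nonneg ?_ fun θ => ?_
  · ext a b
    simp [add_comm]
  · rw [star_trivial]
    rcases isEmpty_or_nonempty (Fin d) with hd | ⟨⟨i⟩⟩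
    · simp [dotProduct]
    · obtain ⟨G', hG'⟩ := hcorr θ
      exact hG'.const_nonneg hP hH (fun i L => Finset.sum_nonneg fun j _ =>
        mul_nonneg (Matrix.nonneg_of_mem_rowStochastic hP) (sq_nonneg _)) i

/-- The central limit theorem for a linear combination of increments affine in the running
weights. -/
lemma IsMarkovChain.tendsto_charFun_affine {Ω : Type*} [MeasurableSpace Ω] {μ : Measure Ω}
    [IsProbabilityMeasure μ] {X : ℕ → Ω → Fin d} (hX : IsMarkovChain μ P X)
    (hP : P ∈ Matrix.rowStochastic ℝ (Fin d)) {u : Fin d → ℝ} {β : ℝ}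
    (hH : IsSubinvariant (momentMatrix A P 2) u β)
    {e : Fin d × Fin d → Fin d → Fin d → ℝ}
    {f : Fin d × Fin d → Fin d → (Fin d → Fin d → Bool) → Fin d → ℝ}
    {θ : Fin d × Fin d → ℝ} {v : ℝ} (hv : 0 ≤ v) {G : Fin d → Matrix (Fin d) (Fin d) ℝ → ℝ}
    (hmean : ∀ a i L, ∑ j, P i j * (L a.1 a.2 * e a i j + f a i (pattern L) j) = 0)
    (hG : IsCorrector A P (fun i L => ∑ j, P i j *
        (∑ a, θ a * (L a.1 a.2 * e a i j + f a i (pattern L) j)) ^ 2) v G) :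
    Tendsto (fun K : ℕ => ∫ ω, Complex.exp (Complex.I * (((√(K : ℝ))⁻¹ *
        pathSum (nextWeights A P) 0 (fun i L j => ∑ a, θ a *
          (L a.1 a.2 * e a i j + f a i (pattern L) j)) (fun k => X k ω) K : ℝ) : ℂ)) ∂μ) atTop
      (𝓝 (Complex.exp (-(v / 2 : ℝ)))) := by
  obtain ⟨δ, hδ0, hδ1, B, hB⟩ := hX.exists_integral_size_rpow_le hP hH
  obtain ⟨⟨C, hC0, hC⟩, hGeq⟩ := hG
  obtain ⟨C₁, hC₁, hC₁'⟩ := exists_size_nextWeights_le A P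
  obtain ⟨E, hE0, hE⟩ := exists_abs_le fun x : (Fin d × Fin d) × Fin d × Fin d =>
    e x.1 x.2.1 x.2.2
  obtain ⟨E', hE0', hE'⟩ := exists_abs_le
    fun x : (Fin d × Fin d) × Fin d × (Fin d → Fin d → Bool) × Fin d =>
      f x.1 x.2.1 x.2.2.1 x.2.2.2
  have hθ0 : 0 ≤ ∑ a, |θ a| := Finset.sum_nonneg fun a _ => abs_nonneg _
  have hDle : ∀ i L j, |∑ a, θ a * (L a.1 a.2 * e a i j + f a i (pattern L) j)| ≤
      (∑ a, |θ a|) * (E + E') * size L := by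
    intro i L j
    refine (Finset.abs_sum_le_sum_abs _ _).trans ?_
    rw [mul_assoc, Finset.sum_mul]
    refine Finset.sum_le_sum fun a _ => ?_
    rw [abs_mul]
    refine mul_le_mul_of_nonneg_left ((abs_add_le _ _).trans ?_) (abs_nonneg _)
    rw [abs_mul]
    have h1 : |L a.1 a.2| * |e a i j| ≤ size L * E :=
      mul_le_mul (abs_le_size L _ _) (hE (a, i, j)) (abs_nonneg _)
        (zero_le_one.trans (one_le_size L))
    have h2 : |f a i (pattern L) j| ≤ E' * size L :=
      (hE' (a, i, pattern L, j)).trans (le_mul_of_one_le_right hE0' (one_le_size L))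
    linarith
  -- one constant dominating increments, correctors, and correctors after the step
  set M : ℝ := 1 + (∑ a, |θ a|) * (E + E') + C * C₁ ^ 2 with hM
  have hθE : 0 ≤ (∑ a, |θ a|) * (E + E') := mul_nonneg hθ0 (add_nonneg hE0 hE0')
  have hCC : 0 ≤ C * C₁ ^ 2 := by positivity
  have hM1 : 1 ≤ M := by linarith
  have hMM : C * C₁ ^ 2 ≤ M ^ 2 := by nlinarith
  have hs0 : ∀ L : Matrix (Fin d) (Fin d) ℝ, 0 ≤ size L := fun L =>
    zero_le_one.trans (one_le_size L)
  refine hX.tendsto_charFun_pathSum (τ := nextWeights A P) (s₀ := 0) hP hδ0 hδ1 hv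
    (G := G) (N := fun _ L => M * size L) (B := M ^ (2 + δ) * B) (fun i L => ?_) (fun i L => ?_)
    (fun i L => hGeq i L) (fun i L j _ => ?_) (fun i L j _ => ?_) (fun i L => ?_) (fun n => ?_)
  · nlinarith [one_le_size L]
  · simp only [Finset.mul_sum]
    rw [Finset.sum_comm]
    refine Finset.sum_eq_zero fun a _ => ?_
    simp only [mul_left_comm _ (θ a), ← Finset.mul_sum]
    rw [hmean, mul_zero]
  · exact (hDle i L j).trans (mul_le_mul_of_nonneg_right (by linarith) (hs0 L))
  · refine (hC _ _).trans ?_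
    have h1 : size (nextWeights A P i j L) ^ 2 ≤ (C₁ * size L) ^ 2 :=
      pow_le_pow_left₀ (hs0 _) (hC₁' i j L) 2
    calc _ ≤ C * (C₁ * size L) ^ 2 := mul_le_mul_of_nonneg_left h1 hC0
      _ = C * C₁ ^ 2 * size L ^ 2 := by ring
      _ ≤ M ^ 2 * size L ^ 2 := mul_le_mul_of_nonneg_right hMM (sq_nonneg _)
      _ = _ := by ring
  · refine (hC _ _).trans ?_
    have h1 : C ≤ M ^ 2 :=
      (le_mul_of_one_le_right hC0 (one_le_pow₀ hC₁)).trans hMM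
    rw [mul_pow]
    exact mul_le_mul_of_nonneg_right h1 (sq_nonneg _)
  · have e1 : ∀ L : Matrix (Fin d) (Fin d) ℝ,
        (M * size L) ^ (2 + δ) = M ^ (2 + δ) * size L ^ (2 + δ) := fun L =>
      Real.mul_rpow (by linarith) (hs0 L)
    simp only [e1]
    rw [integral_const_mul]
    exact mul_le_mul_of_nonneg_left (hB n) (Real.rpow_nonneg (by linarith) _)

end Poisson

/-! ### The Green matrix and the mean weight of a cycle -/

section Green

variable {d : ℕ}

/-- The column `l` of `C` scaled to have the value `1` at `l`: the mean weight collected on the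
way from `j` to the first visit of `l`, for `j ≠ l`. -/
noncomputable def hitWeight (C : Matrix (Fin d) (Fin d) ℝ) (l j : Fin d) : ℝ := C j l / C l l

/-- The mean weight of a cycle that starts at `i` and ends at the next visit of `l`. -/
noncomputable def cycleWeight (A C : Matrix (Fin d) (Fin d) ℝ) (l i : Fin d) : ℝ :=
  ∑ j, A i j * hitWeight C l j

variable {A C : Matrix (Fin d) (Fin d) ℝ} {u : Fin d → ℝ} {β : ℝ}

lemma one_sub_mul_of_isSubinvariant (hA : IsSubinvariant (fun i j => |A i j|) u β)
    (hC : C = (1 - A)⁻¹) : (1 - A) * C = 1 := by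
  have hunit : IsUnit (1 - A) := by
    rw [← Matrix.mulVec_injective_iff_isUnit]
    refine (injective_iff_map_eq_zero (Matrix.mulVecLin (1 - A))).2 fun y hy => ?_
    have h1 : ∀ i, y i = ∑ j, A i j * y j := fun i => by
      have := congrFun hy i
      simp only [Matrix.mulVecLin_apply, Matrix.sub_mulVec, Matrix.one_mulVec, Pi.sub_apply,
        Pi.zero_apply] at this
      exact sub_eq_zero.1 this
    refine hA.eq_zero_of_abs_le_sum fun i => ?_
    conv_lhs => rw [h1 i]
    refine (Finset.abs_sum_le_sum_abs _ _).trans (le_of_eq ?_)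
    exact Finset.sum_congr rfl fun j _ => abs_mul _ _
  rw [hC, Matrix.mul_nonsing_inv _ ((Matrix.isUnit_iff_isUnit_det _).1 hunit)]

lemma green_apply (h : (1 - A) * C = 1) (i l : Fin d) :
    C i l = ∑ j, A i j * C j l + if i = l then 1 else 0 := by
  have h1 := congrFun (congrFun h i) l
  rw [Matrix.sub_mul, Matrix.one_mul, Matrix.sub_apply, Matrix.mul_apply, Matrix.one_apply] at h1
  linarith

/-- If `C l l` vanished, column `l` of `C` would solve `y = A y`. -/
lemma green_diag_ne_zero (hA : IsSubinvariant (fun i j => |A i j|) u β)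
    (h : (1 - A) * C = 1) (l : Fin d) : C l l ≠ 0 := by
  intro h0
  have hy : (fun i => C i l) = 0 := by
    refine hA.eq_zero_of_abs_le_sum fun i => ?_
    by_cases hi : i = l
    · rw [hi, h0, abs_zero]
      exact Finset.sum_nonneg fun j _ => mul_nonneg (abs_nonneg _) (abs_nonneg _)
    · rw [green_apply h i l, if_neg hi, add_zero]
      refine (Finset.abs_sum_le_sum_abs _ _).trans (le_of_eq ?_)
      exact Finset.sum_congr rfl fun j _ => abs_mul _ _
  have h1 := green_apply h l l
  have h2 : ∀ j, C j l = 0 := fun j => congrFun hy j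
  simp [h2] at h1

lemma cycleWeight_eq (h : (1 - A) * C = 1) (hC0 : ∀ l, C l l ≠ 0) (l i : Fin d) :
    cycleWeight A C l i = if i = l then 1 - 1 / C l l else C i l / C l l := by
  have h1 : cycleWeight A C l i = (∑ j, A i j * C j l) / C l l := by
    rw [cycleWeight, Finset.sum_div]
    exact Finset.sum_congr rfl fun j _ => by rw [hitWeight, mul_div_assoc]
  have h2 := green_apply h i l
  rw [h1]
  split_ifs with hi
  · rw [if_pos hi, hi] at h2
    rw [hi, eq_sub_of_add_eq h2.symm, sub_div, div_self (hC0 l)]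
  · rw [if_neg hi, add_zero] at h2
    rw [h2]

end Green

/-! ### Martingale decompositions of the cumulative weights and of the cycle counts -/

section Decomposition

variable {d : ℕ} {A P C : Matrix (Fin d) (Fin d) ℝ}

lemma run_eq_pathState (x : ℕ → Fin d) (n : ℕ) :
    run A P x n = pathState (AlgState.next A P) ⟨0, 0, 0⟩ x n := by
  induction n with
  | zero => rfl
  | succ n ih => rw [run, ih]; rfl

lemma dependsOn_run {E : Type*} (ψ : AlgState d → E) (n : ℕ) :
    DependsOn (fun x => ψ (run A P x n)) (Set.Iic n) := by
  intro x y h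
  simp only [run_eq_pathState]
  exact congrArg ψ (dependsOn_pathState n h)

lemma IsMarkovChain.measurable_scaledDeviation {Ω : Type*} [MeasurableSpace Ω] {μ : Measure Ω}
    {X : ℕ → Ω → Fin d} (hX : IsMarkovChain μ P X) (A M : Matrix (Fin d) (Fin d) ℝ) (K : ℕ) :
    Measurable fun ω => scaledDeviation (cumWeights A P (fun n => X n ω) K) M K :=
  hX.measurable_comp (dependsOn_run (fun s => scaledDeviation s.total M K) K)

lemma run_running (x : ℕ → Fin d) (n : ℕ) :
    (run A P x n).running = pathState (nextWeights A P) 0 x n := by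
  induction n with
  | zero => rfl
  | succ n ih => rw [pathState, ← ih]; rfl

lemma run_total_succ (x : ℕ → Fin d) (n : ℕ) (k l : Fin d) :
    (run A P x (n + 1)).total k l = (run A P x n).total k l +
      if l = x (n + 1) then A (x n) (x (n + 1)) / P (x n) (x (n + 1)) *
        (pathState (nextWeights A P) 0 x n k l +
          restartInd k l (x n) (pattern (pathState (nextWeights A P) 0 x n))) else 0 := by
  rw [← scaledWeights_apply, ← run_running]
  change (if l = x (n + 1) then _ else _) = _
  split_ifs
  · rfl
  · rw [add_zero]

lemma run_count_succ (x : ℕ → Fin d) (n : ℕ) (k l : Fin d) :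
    (run A P x (n + 1)).count k l = (run A P x n).count k l +
      if l = x (n + 1) ∧ A (x n) (x (n + 1)) / P (x n) (x (n + 1)) *
        (pathState (nextWeights A P) 0 x n k l +
          restartInd k l (x n) (pattern (pathState (nextWeights A P) 0 x n))) ≠ 0
      then 1 else 0 := by
  rw [← scaledWeights_apply, ← run_running]
  change (if _ then _ else _) = _
  split_ifs
  · rfl
  · rw [add_zero]

/-- The coefficient of the running weight in the martingale increment. -/
noncomputable def slope (A P C : Matrix (Fin d) (Fin d) ℝ) (a : Fin d × Fin d) (i j : Fin d) : ℝ :=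
  A i j / P i j * hitWeight C a.2 j - cycleWeight A C a.2 i

/-- The increment of the martingale part of the number of starts of a cycle, when `g` solves the
Poisson equation for the indicator of a start. -/
noncomputable def startIncr (A P : Matrix (Fin d) (Fin d) ℝ)
    (g : Fin d → (Fin d → Fin d → Bool) → ℝ) (i : Fin d) (s : Fin d → Fin d → Bool)
    (j : Fin d) : ℝ :=
  g j (nextPattern A P i j s) - transOp P (nextPattern A P) g i s

/-- The part of the martingale increment that depends on the pattern of open cycles only. -/
noncomputable def offset (A P C : Matrix (Fin d) (Fin d) ℝ)
    (g : Fin d × Fin d → Fin d → (Fin d → Fin d → Bool) → ℝ)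
    (a : Fin d × Fin d) (i : Fin d) (s : Fin d → Fin d → Bool) (j : Fin d) : ℝ :=
  restartInd a.1 a.2 i s * slope A P C a i j +
    cycleWeight A C a.2 a.1 * startIncr A P (g a) i s j

lemma sum_mul_startIncr (hP : P ∈ Matrix.rowStochastic ℝ (Fin d))
    (g : Fin d → (Fin d → Fin d → Bool) → ℝ) (i : Fin d) (s : Fin d → Fin d → Bool) :
    ∑ j, P i j * startIncr A P g i s j = 0 := by
  simp only [startIncr, mul_sub, Finset.sum_sub_distrib]
  rw [← Finset.sum_mul, Matrix.sum_row_of_mem_rowStochastic hP, one_mul]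
  exact sub_self _

lemma sum_mul_increment (hP : P ∈ Matrix.rowStochastic ℝ (Fin d))
    (hAP : ∀ i j, P i j = 0 → A i j = 0)
    (g : Fin d × Fin d → Fin d → (Fin d → Fin d → Bool) → ℝ) (a : Fin d × Fin d) (i : Fin d)
    (L : Matrix (Fin d) (Fin d) ℝ) :
    ∑ j, P i j * (L a.1 a.2 * slope A P C a i j + offset A P C g a i (pattern L) j) = 0 := by
  have h1 : ∑ j, P i j * slope A P C a i j = 0 := by
    simp only [slope, mul_sub, Finset.sum_sub_distrib, ← mul_assoc, mul_div_eq_of_imp hAP]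
    rw [← Finset.sum_mul, Matrix.sum_row_of_mem_rowStochastic hP, one_mul]
    exact sub_self _
  have e : ∀ j, P i j * (L a.1 a.2 * slope A P C a i j + offset A P C g a i (pattern L) j) =
      (L a.1 a.2 + restartInd a.1 a.2 i (pattern L)) * (P i j * slope A P C a i j) +
        cycleWeight A C a.2 a.1 * (P i j * startIncr A P (g a) i (pattern L) j) := fun j => by
    rw [offset]
    ring
  simp only [e, Finset.sum_add_distrib, ← Finset.mul_sum]
  rw [h1, sum_mul_startIncr hP]
  ring

/-- The cumulative weight is the sum of a martingale, of a linear drift, and of a term controlled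
by the current state. The drift is the rate of starts of a cycle times its mean weight. -/
lemma pathSum_increment_eq (h : (1 - A) * C = 1) (hC0 : ∀ l, C l l ≠ 0)
    {g : Fin d × Fin d → Fin d → (Fin d → Fin d → Bool) → ℝ} {c : Fin d × Fin d → ℝ}
    (hg : ∀ a i s, restartInd a.1 a.2 i s =
      c a + g a i s - transOp P (nextPattern A P) (g a) i s)
    (a : Fin d × Fin d) (x : ℕ → Fin d) (K : ℕ) :
    pathSum (nextWeights A P) 0 (fun i L j =>
        L a.1 a.2 * slope A P C a i j + offset A P C g a i (pattern L) j) x K =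
      cumWeights A P x K a.1 a.2 - K * (c a * cycleWeight A C a.2 a.1) +
        (cycleWeight A C a.2 (x K) * pathState (nextWeights A P) 0 x K a.1 a.2 +
          cycleWeight A C a.2 a.1 * (g a (x K) (pattern (pathState (nextWeights A P) 0 x K)) -
            g a (x 0) (pattern 0))) := by
  induction K with
  | zero => simp [pathSum, cumWeights, run, pathState]
  | succ K ih =>
    rw [pathSum_succ, ih, cumWeights, cumWeights, run_total_succ]
    simp only [pathState]
    rw [pattern_nextWeights, nextWeights_apply]
    set L := pathState (nextWeights A P) 0 x K with hL
    set i := x K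
    set j := x (K + 1)
    have h1 := hg a i (pattern L)
    have h2 : restartInd a.1 a.2 i (pattern L) * cycleWeight A C a.2 i =
        restartInd a.1 a.2 i (pattern L) * cycleWeight A C a.2 a.1 := by
      unfold restartInd
      split_ifs with hi
      · rw [hi.1]
      · simp
    have h3 : A i j / P i j * (L a.1 a.2 + restartInd a.1 a.2 i (pattern L)) * hitWeight C a.2 j =
        (if a.2 = j then A i j / P i j * (L a.1 a.2 + restartInd a.1 a.2 i (pattern L)) else 0) +
        cycleWeight A C a.2 j * (if a.2 = j then 0 else
          A i j / P i j * (L a.1 a.2 + restartInd a.1 a.2 i (pattern L))) := by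
      split_ifs with hj
      · rw [← hj, hitWeight, div_self (hC0 _)]
        ring
      · rw [cycleWeight_eq h hC0, if_neg (Ne.symm hj), hitWeight]
        ring
    simp only [offset, slope, startIncr]
    push_cast
    linear_combination h3 - h2 - cycleWeight A C a.2 a.1 * h1

lemma count_increment_add {i j k l : Fin d} (hij : A i j / P i j ≠ 0)
    (L : Matrix (Fin d) (Fin d) ℝ) :
    (if l = j ∧ A i j / P i j * (L k l + restartInd k l i (pattern L)) ≠ 0 then (1 : ℝ) else 0) +
        (if nextPattern A P i j (pattern L) k l then 1 else 0) =
      (if pattern L k l then 1 else 0) + restartInd k l i (pattern L) := by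
  have e : (l = j ∧ A i j / P i j * (L k l + restartInd k l i (pattern L)) ≠ 0) ↔
      (l = j ∧ (L k l ≠ 0 ∨ k = i)) := by
    rw [mul_ne_zero_iff, restartRow_ne_zero_iff]
    tauto
  rw [if_congr e rfl rfl]
  by_cases hl : l = j <;> by_cases hk : k = i <;> by_cases hp : L k l = 0 <;>
    (try subst hl) <;> (try subst hk) <;> simp_all [pattern, nextPattern, restartInd]

/-- If every possible transition has a nonzero weight, an open cycle is never interrupted, and the
cycle count is the number of starts up to the cycle that is still open. -/
lemma cycleCounts_eq {k l : Fin d} {c : ℝ} {g : Fin d → (Fin d → Fin d → Bool) → ℝ}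
    (hg : ∀ i s, restartInd k l i s = c + g i s - transOp P (nextPattern A P) g i s)
    {x : ℕ → Fin d} (hx : ∀ n, A (x n) (x (n + 1)) / P (x n) (x (n + 1)) ≠ 0) (K : ℕ) :
    (cycleCounts A P x K k l : ℝ) = K * c +
      pathSum (nextWeights A P) 0 (fun i L j => startIncr A P g i (pattern L) j) x K +
      (g (x 0) (pattern 0) - g (x K) (pattern (pathState (nextWeights A P) 0 x K)) -
        if pattern (pathState (nextWeights A P) 0 x K) k l then 1 else 0) := by
  induction K with
  | zero => simp [pathSum, cycleCounts, run, pathState, pattern]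
  | succ K ih =>
    have ih' : ((run A P x K).count k l : ℝ) = _ := ih
    rw [pathSum_succ, cycleCounts, run_count_succ]
    push_cast
    rw [ih']
    simp only [pathState, pattern_nextWeights]
    set L := pathState (nextWeights A P) 0 x K with hL
    have h1 := hg (x K) (pattern L)
    have h3 := count_increment_add (k := k) (l := l) (hx K) L
    simp only [startIncr]
    linear_combination h3 + h1

end Decomposition

/-! ### Limit theorems for the algorithm -/

section Main

variable {d : ℕ} {A P C : Matrix (Fin d) (Fin d) ℝ} {Ω : Type*} [MeasurableSpace Ω]
  {μ : Measure Ω} [IsProbabilityMeasure μ] {X : ℕ → Ω → Fin d}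

lemma IsMarkovChain.ae_tendsto_cycleCounts (hX : IsMarkovChain μ P X)
    (hP : P ∈ Matrix.rowStochastic ℝ (Fin d)) (hPA : ∀ i j, A i j = 0 → P i j = 0) {k l : Fin d}
    {c : ℝ} {g : Fin d → (Fin d → Fin d → Bool) → ℝ}
    (hg : ∀ i s, restartInd k l i s = c + g i s - transOp P (nextPattern A P) g i s) :
    ∀ᵐ ω ∂μ, Tendsto (fun K : ℕ => (cycleCounts A P (fun n => X n ω) K k l : ℝ) / (K : ℝ)) atTop
      (𝓝 c) := by
  obtain ⟨b, hb0, hb⟩ := exists_abs_le fun z : Fin d × (Fin d → Fin d → Bool) × Fin d =>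
    startIncr A P g z.1 z.2.1 z.2.2
  obtain ⟨B, hB0, hB⟩ := exists_abs_le fun z : Fin d × (Fin d → Fin d → Bool) => g z.1 z.2
  have hslln := hX.ae_tendsto_pathSum_div (τ := nextWeights A P) (s₀ := 0) hP
    (D := fun i L j => startIncr A P g i (pattern L) j)
    (fun i L => sum_mul_startIncr hP g i (pattern L)) (fun i L j => hb (i, pattern L, j))
  filter_upwards [hslln, hX.ae_pos fun i j => Matrix.nonneg_of_mem_rowStochastic hP]
    with ω hω hpos
  set x : ℕ → Fin d := fun n => X n ω
  have hx : ∀ n, A (x n) (x (n + 1)) / P (x n) (x (n + 1)) ≠ 0 := fun n =>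
    div_ne_zero (fun h0 => (hpos n).ne' (hPA _ _ h0)) (hpos n).ne'
  set R : ℕ → ℝ := fun K =>
    g (x 0) (pattern 0) - g (x K) (pattern (pathState (nextWeights A P) 0 x K)) -
        if pattern (pathState (nextWeights A P) 0 x K) k l then 1 else 0 with hR
  have hRle : ∀ K, |R K| ≤ B + B + 1 := by
    intro K
    refine (abs_sub _ _).trans (add_le_add ((abs_sub _ _).trans
      (add_le_add (hB (_, _)) (hB (_, _)))) ?_)
    split_ifs <;> simp
  have hR0 : Tendsto (fun K : ℕ => R K / (K : ℝ)) atTop (𝓝 0) := by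
    refine squeeze_zero_norm (fun K => ?_) (tendsto_const_div_atTop_nhds_zero_nat (B + B + 1))
    rw [Real.norm_eq_abs, abs_div, Nat.abs_cast]
    exact div_le_div_of_nonneg_right (hRle K) (Nat.cast_nonneg K)
  have hlim := (hω.const_add c).add hR0
  simp only [add_zero] at hlim
  refine hlim.congr' ?_
  filter_upwards [eventually_gt_atTop 0] with K hK
  have hK' : (K : ℝ) ≠ 0 := by exact_mod_cast hK.ne'
  rw [cycleCounts_eq hg hx K, add_div, add_div, mul_div_cancel_left₀ _ hK']

lemma sqrt_mul_div_sub (K : ℕ) (m γ : ℝ) :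
    √(K : ℝ) * (m / K - γ) = (√(K : ℝ))⁻¹ * (m - K * γ) := by
  rcases Nat.eq_zero_or_pos K with rfl | hK
  · simp
  · have hK' : (0 : ℝ) < K := by exact_mod_cast hK
    have hs : √(K : ℝ) ≠ 0 := (Real.sqrt_pos.2 hK').ne'
    have hsq : √(K : ℝ) * √(K : ℝ) = K := Real.mul_self_sqrt hK'.le
    field_simp
    rw [sq, hsq]

/-- The boundary term in the martingale decomposition of the combination of the cumulative weights
with coefficients `θ`. -/
noncomputable def boundary (A P C : Matrix (Fin d) (Fin d) ℝ)
    (g : Fin d × Fin d → Fin d → (Fin d → Fin d → Bool) → ℝ) (θ : Fin d × Fin d → ℝ)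
    (x : ℕ → Fin d) (K : ℕ) : ℝ :=
  ∑ a, θ a * (cycleWeight A C a.2 (x K) * pathState (nextWeights A P) 0 x K a.1 a.2 +
    cycleWeight A C a.2 a.1 * (g a (x K) (pattern (pathState (nextWeights A P) 0 x K)) -
      g a (x 0) (pattern 0)))

/-- The increments of the martingale part of the combination of the cumulative weights with
coefficients `θ`. -/
noncomputable def increment (A P C : Matrix (Fin d) (Fin d) ℝ)
    (g : Fin d × Fin d → Fin d → (Fin d → Fin d → Bool) → ℝ) (θ : Fin d × Fin d → ℝ)
    (i : Fin d) (L : Matrix (Fin d) (Fin d) ℝ) (j : Fin d) : ℝ :=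
  ∑ a, θ a * (L a.1 a.2 * slope A P C a i j + offset A P C g a i (pattern L) j)

lemma inner_scaledDeviation (h : (1 - A) * C = 1) (hC0 : ∀ l, C l l ≠ 0)
    {g : Fin d × Fin d → Fin d → (Fin d → Fin d → Bool) → ℝ} {c : Fin d × Fin d → ℝ}
    (hg : ∀ a i s, restartInd a.1 a.2 i s =
      c a + g a i s - transOp P (nextPattern A P) (g a) i s) {M : Matrix (Fin d) (Fin d) ℝ}
    (hM : ∀ i j, M i j = c (i, j) * cycleWeight A C j i)
    (θ : EuclideanSpace ℝ (Fin d × Fin d)) (x : ℕ → Fin d) (K : ℕ) :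
    inner ℝ (scaledDeviation (cumWeights A P x K) M K) θ =
      (√(K : ℝ))⁻¹ * pathSum (nextWeights A P) 0 (increment A P C g θ) x K -
        (√(K : ℝ))⁻¹ * boundary A P C g θ x K := by
  have hsum : pathSum (nextWeights A P) 0 (increment A P C g θ) x K =
      ∑ a, θ a * pathSum (nextWeights A P) 0 (fun i L j =>
        L a.1 a.2 * slope A P C a i j + offset A P C g a i (pattern L) j) x K := by
    simp only [increment, pathSum, Finset.mul_sum]
    rw [Finset.sum_comm]
  rw [hsum, ← mul_sub, boundary, ← Finset.sum_sub_distrib, PiLp.inner_apply, Finset.mul_sum]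
  refine Finset.sum_congr rfl fun a _ => ?_
  rw [pathSum_increment_eq h hC0 hg]
  simp only [scaledDeviation, sqrt_mul_div_sub, hM]
  simp only [RCLike.inner_apply, conj_trivial]
  ring

lemma exists_abs_boundary_le (A P C : Matrix (Fin d) (Fin d) ℝ)
    (g : Fin d × Fin d → Fin d → (Fin d → Fin d → Bool) → ℝ) (θ : Fin d × Fin d → ℝ) :
    ∃ Q, 0 ≤ Q ∧ ∀ x K, |boundary A P C g θ x K| ≤
      Q * size (pathState (nextWeights A P) 0 x K) := by
  obtain ⟨E, hE0, hE⟩ := exists_abs_le fun z : Fin d × Fin d => cycleWeight A C z.1 z.2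
  obtain ⟨E', hE0', hE'⟩ := exists_abs_le
    fun z : (Fin d × Fin d) × Fin d × (Fin d → Fin d → Bool) => g z.1 z.2.1 z.2.2
  refine ⟨(∑ a, |θ a|) * (E * (1 + (E' + E'))),
    mul_nonneg (Finset.sum_nonneg fun a _ => abs_nonneg _) (by positivity), fun x K => ?_⟩
  refine (Finset.abs_sum_le_sum_abs _ _).trans ?_
  rw [mul_assoc, Finset.sum_mul]
  refine Finset.sum_le_sum fun a _ => ?_
  rw [abs_mul]
  refine mul_le_mul_of_nonneg_left ((abs_add_le _ _).trans ?_) (abs_nonneg _)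
  rw [abs_mul, abs_mul]
  have hs := one_le_size (pathState (nextWeights A P) 0 x K)
  have h1 : |cycleWeight A C a.2 (x K)| * |pathState (nextWeights A P) 0 x K a.1 a.2| ≤
      E * size (pathState (nextWeights A P) 0 x K) :=
    mul_le_mul (hE (_, _)) (abs_le_size _ _ _) (abs_nonneg _) hE0
  have h2 : |cycleWeight A C a.2 a.1| *
      |g a (x K) (pattern (pathState (nextWeights A P) 0 x K)) - g a (x 0) (pattern 0)| ≤
      E * (E' + E') :=
    mul_le_mul (hE (_, _)) ((abs_sub _ _).trans
      (add_le_add (hE' (a, _, _)) (hE' (a, _, _)))) (abs_nonneg _) hE0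
  have h3 : E * (E' + E') ≤ E * (E' + E') * size (pathState (nextWeights A P) 0 x K) :=
    le_mul_of_one_le_right (by positivity) hs
  linarith

lemma norm_exp_sub_mul_I_sub_le (s r : ℝ) :
    ‖Complex.exp (((s - r : ℝ) : ℂ) * Complex.I) - Complex.exp (Complex.I * (s : ℂ))‖ ≤ |r| := by
  have e : Complex.exp (((s - r : ℝ) : ℂ) * Complex.I) - Complex.exp (Complex.I * (s : ℂ)) =
      Complex.exp ((s : ℂ) * Complex.I) *
        (Complex.exp (Complex.I * ((-r : ℝ) : ℂ)) - 1) := by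
    rw [mul_sub, ← Complex.exp_add, mul_one, mul_comm Complex.I (s : ℂ)]
    congr 2
    push_cast
    ring
  rw [e, norm_mul, Complex.norm_exp_ofReal_mul_I, one_mul]
  refine Real.norm_exp_I_mul_ofReal_sub_one_le.trans ?_
  rw [norm_neg, Real.norm_eq_abs]

/-- The boundary term of the martingale decomposition does not contribute to the limit law. -/
lemma IsMarkovChain.tendsto_charFun_sub (hX : IsMarkovChain μ P X)
    (hP : P ∈ Matrix.rowStochastic ℝ (Fin d)) {u : Fin d → ℝ} {β : ℝ}
    (hH : IsSubinvariant (momentMatrix A P 2) u β)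
    {g : Fin d × Fin d → Fin d → (Fin d → Fin d → Bool) → ℝ} {M : Matrix (Fin d) (Fin d) ℝ}
    {θ : EuclideanSpace ℝ (Fin d × Fin d)}
    (hinner : ∀ x K, inner ℝ (scaledDeviation (cumWeights A P x K) M K) θ =
      (√(K : ℝ))⁻¹ * pathSum (nextWeights A P) 0 (increment A P C g θ) x K -
        (√(K : ℝ))⁻¹ * boundary A P C g θ x K) :
    Tendsto (fun K : ℕ => charFun (μ.map fun ω =>
      scaledDeviation (cumWeights A P (fun n => X n ω) K) M K) θ -
      ∫ ω, Complex.exp (Complex.I * (((√(K : ℝ))⁻¹ *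
        pathSum (nextWeights A P) 0 (increment A P C g θ) (fun n => X n ω) K : ℝ) : ℂ)) ∂μ) atTop
      (𝓝 0) := by
  obtain ⟨δ, hδ0, hδ1, B, hB⟩ := hX.exists_integral_size_rpow_le hP hH
  obtain ⟨Q, hQ0, hQ⟩ := exists_abs_boundary_le A P C g θ
  have hlim : Tendsto (fun K : ℕ => (√(K : ℝ))⁻¹ * (Q * B)) atTop (𝓝 0) := by
    have h1 : Tendsto (fun K : ℕ => (√(K : ℝ))⁻¹) atTop (𝓝 0) :=
      tendsto_inv_atTop_zero.comp (Real.tendsto_sqrt_atTop.comp tendsto_natCast_atTop_atTop)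
    simpa using h1.mul_const (Q * B)
  refine squeeze_zero_norm (fun K => ?_) hlim
  have hcf : charFun (μ.map fun ω =>
      scaledDeviation (cumWeights A P (fun n => X n ω) K) M K) θ =
      ∫ ω, Complex.exp ((inner ℝ (scaledDeviation (cumWeights A P (fun n => X n ω) K) M K) θ : ℝ) *
        Complex.I) ∂μ := by
    rw [charFun_apply,
      integral_map (hX.measurable_scaledDeviation A M K).aemeasurable (by fun_prop)]
  have hi1 : Integrable (fun ω => Complex.exp ((inner ℝ (scaledDeviation
      (cumWeights A P (fun n => X n ω) K) M K) θ : ℝ) * Complex.I)) μ :=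
    hX.integrable_comp (dependsOn_run (fun s => Complex.exp
      ((inner ℝ (scaledDeviation s.total M K) θ : ℝ) * Complex.I)) K)
  have hi2 : Integrable (fun ω => Complex.exp (Complex.I * (((√(K : ℝ))⁻¹ *
      pathSum (nextWeights A P) 0 (increment A P C g θ) (fun n => X n ω) K : ℝ) : ℂ))) μ :=
    hX.integrable_state (τ := nextWeights A P) (s₀ := 0) (increment A P C g θ) K
      fun _ _ t => Complex.exp (Complex.I * (((√(K : ℝ))⁻¹ * t : ℝ) : ℂ))
  have hi3 : Integrable (fun ω => (√(K : ℝ))⁻¹ *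
      (Q * size (pathState (nextWeights A P) 0 (fun n => X n ω) K) ^ (2 + δ))) μ :=
    hX.integrable_state (τ := nextWeights A P) (s₀ := 0) (fun _ _ _ => 0) K
      fun _ L _ => (√(K : ℝ))⁻¹ * (Q * size L ^ (2 + δ))
  rw [hcf, ← integral_sub hi1 hi2]
  have hle : ∀ ω, ‖Complex.exp ((inner ℝ (scaledDeviation
        (cumWeights A P (fun n => X n ω) K) M K) θ : ℝ) * Complex.I) -
        Complex.exp (Complex.I * (((√(K : ℝ))⁻¹ *
          pathSum (nextWeights A P) 0 (increment A P C g θ) (fun n => X n ω) K : ℝ) : ℂ))‖ ≤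
      (√(K : ℝ))⁻¹ * (Q * size (pathState (nextWeights A P) 0 (fun n => X n ω) K)
        ^ (2 + δ)) := by
    intro ω
    rw [hinner]
    refine (norm_exp_sub_mul_I_sub_le _ _).trans ?_
    rw [abs_mul, abs_of_nonneg (by positivity)]
    refine mul_le_mul_of_nonneg_left ((hQ _ _).trans
      (mul_le_mul_of_nonneg_left ?_ hQ0)) (by positivity)
    exact Real.self_le_rpow_of_one_le (one_le_size _) (by linarith)
  refine (norm_integral_le_of_norm_le hi3 (ae_of_all _ hle)).trans ?_
  rw [integral_const_mul, integral_const_mul]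
  exact mul_le_mul_of_nonneg_left (mul_le_mul_of_nonneg_left (hB K) hQ0) (by positivity)

/-- The central limit theorem for the cumulative weights, the covariance matrix `V` being given by
the Poisson equations of the conditional covariances of the martingale increments. -/
lemma IsMarkovChain.tendstoInDistribution_scaledDeviation (hX : IsMarkovChain μ P X)
    (hP : P ∈ Matrix.rowStochastic ℝ (Fin d)) (hAP : ∀ i j, P i j = 0 → A i j = 0)
    {u : Fin d → ℝ} {β : ℝ} (hH : IsSubinvariant (momentMatrix A P 2) u β)
    (h : (1 - A) * C = 1) (hC0 : ∀ l, C l l ≠ 0)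
    {g : Fin d × Fin d → Fin d → (Fin d → Fin d → Bool) → ℝ} {c : Fin d × Fin d → ℝ}
    (hg : ∀ a i s, restartInd a.1 a.2 i s =
      c a + g a i s - transOp P (nextPattern A P) (g a) i s)
    {V : Matrix (Fin d × Fin d) (Fin d × Fin d) ℝ} (hV : V.PosSemidef)
    (hVG : ∀ θ : Fin d × Fin d → ℝ, ∃ G, IsCorrector A P (fun i L => ∑ j, P i j *
        (∑ a, θ a * (L a.1 a.2 * slope A P C a i j + offset A P C g a i (pattern L) j)) ^ 2)
        (θ ⬝ᵥ V.mulVec θ) G) {M : Matrix (Fin d) (Fin d) ℝ}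
    (hM : ∀ i j, M i j = c (i, j) * cycleWeight A C j i) :
    TendstoInDistribution
      (fun (K : ℕ) (ω : Ω) => scaledDeviation (cumWeights A P (fun n => X n ω) K) M K)
      atTop (id : EuclideanSpace ℝ (Fin d × Fin d) → EuclideanSpace ℝ (Fin d × Fin d))
      (fun _ => μ) (multivariateGaussian 0 V) := by
  refine ⟨fun K => (hX.measurable_scaledDeviation A M K).aemeasurable, by fun_prop, ?_⟩
  refine ProbabilityMeasure.tendsto_iff_tendsto_charFun.2 fun θ => ?_
  simp only [ProbabilityMeasure.coe_mk, Measure.map_id]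
  rw [charFun_multivariateGaussian hV]
  obtain ⟨G, hG⟩ := hVG θ
  have hv : 0 ≤ (θ : Fin d × Fin d → ℝ) ⬝ᵥ V.mulVec θ := by
    simpa using hV.dotProduct_mulVec_nonneg (θ : Fin d × Fin d → ℝ)
  have hclt : Tendsto (fun K : ℕ => ∫ ω, Complex.exp (Complex.I * (((√(K : ℝ))⁻¹ *
      pathSum (nextWeights A P) 0 (increment A P C g θ) (fun n => X n ω) K : ℝ) : ℂ)) ∂μ) atTop
      (𝓝 (Complex.exp (-(((θ : Fin d × Fin d → ℝ) ⬝ᵥ V.mulVec θ) / 2 : ℝ)))) :=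
    hX.tendsto_charFun_affine hP hH hv (fun a i L => sum_mul_increment (C := C) hP hAP g a i L) hG
  have hsum := (hX.tendsto_charFun_sub hP hH
    (inner_scaledDeviation h hC0 hg hM θ)).add hclt
  simp only [sub_add_cancel, zero_add] at hsum
  convert hsum using 3
  rw [inner_zero_right]
  push_cast
  ring

end Main

end RegenUvN

theorem theorem4p5 {d : ℕ} (A P : Matrix (Fin d) (Fin d) ℝ)
    (hA : RegenUvN.specRad A < 1)
    (hP : P ∈ Matrix.rowStochastic ℝ (Fin d))
    (hirr : P.IsIrreducible)
    (haper : RegenUvN.Aperiodic P)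
    (hAP : ∀ i j, P i j = 0 → A i j = 0)
    (hconv : RegenUvN.specRad (RegenUvN.secondMomentMatrix A P) < 1)
    (C : Matrix (Fin d) (Fin d) ℝ) (hC : C = (1 - A)⁻¹) :
    ∃ (Γs : Matrix (Fin d) (Fin d) ℝ) (Sa : Matrix (Fin d × Fin d) (Fin d × Fin d) ℝ),
      Sa.PosSemidef ∧
      (∀ (Ω : Type*) [MeasurableSpace Ω] (μ : Measure Ω) [IsProbabilityMeasure μ]
        (X : ℕ → Ω → Fin d), RegenUvN.IsMarkovChain μ P X →
        TendstoInDistribution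
          (fun (K : ℕ) (ω : Ω) =>
            RegenUvN.scaledDeviation (RegenUvN.cumWeights A P (fun n => X n ω) K)
              (fun i j => Γs i j * C i j) K)
          atTop (id : EuclideanSpace ℝ (Fin d × Fin d) → EuclideanSpace ℝ (Fin d × Fin d))
          (fun _ => μ) (multivariateGaussian 0 Sa)) ∧
      ((∀ i j, A i j = 0 → P i j = 0) →
        ∃ γ : Matrix (Fin d) (Fin d) ℝ,
          (∀ i j, Γs i j * C i j =
            γ i j * (if i = j then 1 - 1 / C j j else C i j / C j j)) ∧
          ∀ (Ω : Type*) [MeasurableSpace Ω] (μ : Measure Ω) [IsProbabilityMeasure μ]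
            (X : ℕ → Ω → Fin d), RegenUvN.IsMarkovChain μ P X →
            ∀ᵐ ω ∂μ, ∀ i j, Tendsto
              (fun K : ℕ => (RegenUvN.cycleCounts A P (fun n => X n ω) K i j : ℝ) / (K : ℝ))
              atTop (𝓝 (γ i j))) := by
  open RegenUvN in
  rw [← momentMatrix_two] at hconv
  obtain ⟨u, β, hH⟩ := exists_isSubinvariant
    (momentMatrix_nonneg (fun i j => Matrix.nonneg_of_mem_rowStochastic hP) 2) hconv
  have hAsub := hH.abs_sqrt hP hAP
  have hinv := one_sub_mul_of_isSubinvariant hAsub hC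
  have hC0 := green_diag_ne_zero hAsub hinv
  choose c g hg using fun a : Fin d × Fin d =>
    exists_poisson_pattern (A := A) hP hirr fun i s => restartInd a.1 a.2 i s
  obtain ⟨V, hV, hVG⟩ := exists_covariance hP hirr hAP hH (slope A P C) (offset A P C g)
  have hM : ∀ i j, c (i, j) * cycleWeight A C j i / C i j * C i j =
      c (i, j) * cycleWeight A C j i := by
    intro i j
    by_cases h0 : C i j = 0
    · -- off the diagonal the mean weight of a cycle is proportional to `C i j`
      have hij : i ≠ j := fun hij => hC0 j (hij ▸ h0)
      rw [cycleWeight_eq hinv hC0, if_neg hij, h0]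
      simp
    · exact div_mul_cancel₀ _ h0
  refine ⟨fun i j => c (i, j) * cycleWeight A C j i / C i j, V, hV, ?_, fun hPA => ?_⟩
  · intro Ω _ μ _ X hX
    exact hX.tendstoInDistribution_scaledDeviation hP hAP hH hinv hC0 hg hV hVG hM
  · refine ⟨fun i j => c (i, j), fun i j => ?_, fun Ω _ μ _ X hX => ?_⟩
    · rw [hM, cycleWeight_eq hinv hC0]
    · rw [ae_all_iff]
      intro i
      rw [ae_all_iff]
      intro j
      exact hX.ae_tendsto_cycleCounts hP hPA (hg (i, j))
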